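/- Let $s\ge 0$ be an integer, let $K$ be a finite-dimensional complex Hilbert space, and let $\mathcal H=\ell^2(\mathbb Z^s,K)$. Let $W$ be a unitary quantum walk: a unitary operator on $\mathcal H$ which commutes with the translations $(U_x\psi)(y)=\psi(y-x)$, $x\in\mathbb Z^s$, and for which there is a finite set $N\subset\mathbb Z^s$ such that $(W\psi)(x)$ depends only on the values $\psi(y)$ with $x-y\in N$. Let $\mathcal F:\mathcal H\to L^2((-\pi,\pi]^s,K)$, $(\mathcal F\psi)(p)=(2\pi)^{-s/2}\sum_x e^{ip\cdot x}\psi(x)$, be the Fourier transform, and let $W(p)=\sum_{x\in N}e^{ip\cdot x}W_x$ $(p\in\mathbb R^s)$, with $W_xv=(W(\delta_0\otimes v))(x)$ for $v\in K$, be the unitary operators on $K$ such that $(\mathcal FW\psi)(p)=W(p)(\mathcal F\psi)(p)$. A momentum $p\in\mathbb R^s$ is called regular if in a neighbourhood of $p$ one can write $W(q)=\sum_k e^{i\omega_k(q)}P_k(q)$ with finitely many real-analytic functions $q\mapsto\omega_k(q)\in\mathbb R$ and $q\mapsto P_k(q)$, where the $P_k(q)$ are mutually orthogonal orthogonal projections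 with $\sum_kP_k(q)=1$. At a regular $p$ the group velocity operator is the tuple $V(p)=(V_1(p),\dots,V_s(p))$ of commuting self-adjoint operators $V_\alpha(p)=\sum_k\frac{\partial\omega_k}{\partial p_\alpha}(p)\,P_k(p)$. Assume that almost every $p\in(-\pi,\pi]^s$ is regular. For a bounded Borel function $f:\mathbb R^s\to\mathbb C$ let $f(V)$ be the operator on $\mathcal H$ that acts in momentum space as multiplication by $f(V(p))$ (joint functional calculus), and let $f(Q(t)/t)=W^{-t}f(Q/t)W^{t}$ for $t=1,2,\dots$, where $(f(Q/t)\psi)(x)=f(x/t)\psi(x)$; thus $Q(t)=W^{-t}QW^t$ is the position observable evolved for $t$ steps. Then the bounded operators $f(V)$ are well defined and $Q(t)/t$ converges to $V$ in the following sense. 1. For every continuous $f:\mathbb R^s\to\mathbb C$ vanishing at infinity, $f(Q(t)/t)\to f(V)$ in the weak operator topology as $t\to\infty$. 2. For every density operator $\rho$ on $\mathcal H$ (positive, of trace one), the distributions $B\mapsto\operatorname{tr}\bigl(\rho\,1_B(Q(t)/t)\bigr)$ of $Q(t)/t$ and $B\mapsto\operatorname{tr}\bigl(\rho\,1_B(V)\bigr)$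 of $V$ in the state $\rho$ are Borel probability measures on $\mathbb R^s$, and the former converge weakly to the latter as $t\to\infty$. -/

import Mathlib

open Filter Topology MeasureTheory
open scoped ENNReal ZeroAtInfty InnerProductSpace

noncomputable section

namespace QW

universe u

/-! ## The Hilbert space and its Fourier transform -/

/-- The Hilbert space `ℓ²(ℤˢ, K)` of a particle on the lattice `ℤˢ` with internal space `K`. -/
abbrev Space (s : ℕ) (K : Type u) [NormedAddCommGroup K] : Type u :=
  lp (fun _ : Fin s → ℤ => K) 2

/-- The pairing `p · x` of a momentum with a lattice point. -/
def dot {s : ℕ} (p : Fin s → ℝ) (x : Fin s → ℤ) : ℝ := ∑ i, p i * (x i : ℝ)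

/-- Lebesgue measure on the momentum cell `(-π, π]ˢ`. -/
def momentumMeasure (s : ℕ) : Measure (Fin s → ℝ) :=
  volume.restrict (Set.univ.pi fun _ => Set.Ioc (-Real.pi) Real.pi)

instance (s : ℕ) : IsFiniteMeasure (momentumMeasure s) :=
  ⟨by
    rw [momentumMeasure, Measure.restrict_apply_univ, Real.volume_pi_Ioc]
    exact ENNReal.prod_lt_top fun _ _ => ENNReal.ofReal_lt_top⟩

section Fourier

variable {s : ℕ} {K : Type u} [NormedAddCommGroup K] [InnerProductSpace ℂ K]

/-- The normalized plane wave `p ↦ (2π)^(-s/2) e^{i p·x} v`. -/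
def planeWaveFun (x : Fin s → ℤ) (v : K) (p : Fin s → ℝ) : K :=
  (((2 * Real.pi) ^ (-(s : ℝ) / 2) : ℝ) : ℂ) • Complex.exp (Complex.I * (dot p x : ℂ)) • v

theorem planeWaveFun_continuous (x : Fin s → ℤ) (v : K) :
    Continuous (planeWaveFun x v) := by
  unfold planeWaveFun dot
  fun_prop

theorem planeWaveFun_norm (x : Fin s → ℤ) (v : K) (p : Fin s → ℝ) :
    ‖planeWaveFun x v p‖ = (2 * Real.pi) ^ (-(s : ℝ) / 2) * ‖v‖ := by
  unfold planeWaveFun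
  rw [norm_smul, norm_smul, mul_comm Complex.I, Complex.norm_exp_ofReal_mul_I, one_mul,
    Complex.norm_real, Real.norm_of_nonneg (by positivity)]

theorem planeWaveFun_memLp (x : Fin s → ℤ) (v : K) :
    MemLp (planeWaveFun x v) 2 (momentumMeasure s) :=
  MemLp.of_bound (planeWaveFun_continuous x v).aestronglyMeasurable _
    (ae_of_all _ fun p => (planeWaveFun_norm x v p).le)

theorem integral_exp_int (n : ℤ) :
    ∫ a in Set.Ioc (-Real.pi) Real.pi, Complex.exp (Complex.I * ((a * (n : ℝ) : ℝ) : ℂ)) =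
      if n = 0 then ((2 * Real.pi : ℝ) : ℂ) else 0 := by
  rw [← intervalIntegral.integral_of_le (by linarith [Real.pi_pos])]
  split_ifs with h
  · subst h
    simp
    ring
  · have hc : Complex.I * (n : ℂ) ≠ 0 := mul_ne_zero Complex.I_ne_zero (by exact_mod_cast h)
    have : ∀ a : ℝ, Complex.exp (Complex.I * ((a * (n : ℝ) : ℝ) : ℂ)) =
        Complex.exp ((Complex.I * (n : ℂ)) * (a : ℂ)) := by
      intro a
      congr 1
      push_cast
      ring
    simp_rw [this]
    rw [integral_exp_mul_complex hc, div_eq_zero_iff]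
    left
    rw [sub_eq_zero, Complex.exp_eq_exp_iff_exists_int]
    exact ⟨n, by push_cast; ring⟩

theorem integral_exp_dot (x : Fin s → ℤ) :
    ∫ p, Complex.exp (Complex.I * (dot p x : ℂ)) ∂(momentumMeasure s) =
      if x = 0 then ((2 * Real.pi : ℝ) : ℂ) ^ s else 0 := by
  have h1 : ∀ p : Fin s → ℝ, Complex.exp (Complex.I * (dot p x : ℂ)) =
      ∏ i, Complex.exp (Complex.I * ((p i * (x i : ℝ) : ℝ) : ℂ)) := by
    intro p
    rw [← Complex.exp_sum, dot, ← Finset.mul_sum]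
    push_cast
    rfl
  simp_rw [h1]
  rw [momentumMeasure, volume_pi, Measure.restrict_pi_pi,
    integral_fintype_prod_eq_prod
      (f := fun i (a : ℝ) => Complex.exp (Complex.I * ((a * (x i : ℝ) : ℝ) : ℂ)))]
  simp_rw [integral_exp_int]
  split_ifs with h
  · subst h
    simp
  · obtain ⟨i, hi⟩ := Function.ne_iff.mp h
    exact Finset.prod_eq_zero (Finset.mem_univ i) (if_neg hi)

theorem planeWaveFun_inner (x y : Fin s → ℤ) (v w : K) :
    ∫ p, ⟪planeWaveFun x v p, planeWaveFun y w p⟫_ℂ ∂(momentumMeasure s) =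
      if x = y then ⟪v, w⟫_ℂ else 0 := by
  have h2 : (((2 * Real.pi) ^ (-(s : ℝ) / 2) : ℝ) : ℂ) * (((2 * Real.pi) ^ (-(s : ℝ) / 2) : ℝ) : ℂ)
      * ((2 * Real.pi : ℝ) : ℂ) ^ s = 1 := by
    have hpi : (0 : ℝ) < 2 * Real.pi := by positivity
    rw [← Complex.ofReal_mul, ← Complex.ofReal_pow, ← Complex.ofReal_mul, ← Real.rpow_add hpi,
      ← Real.rpow_natCast (2 * Real.pi) s, ← Real.rpow_add hpi,
      show -(s : ℝ) / 2 + -(s : ℝ) / 2 + (s : ℝ) = 0 by ring, Real.rpow_zero, Complex.ofReal_one]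
  have h1 : ∀ p : Fin s → ℝ, ⟪planeWaveFun x v p, planeWaveFun y w p⟫_ℂ =
      ((((2 * Real.pi) ^ (-(s : ℝ) / 2) : ℝ) : ℂ) * (((2 * Real.pi) ^ (-(s : ℝ) / 2) : ℝ) : ℂ)
        * ⟪v, w⟫_ℂ) * Complex.exp (Complex.I * (dot p (y - x) : ℂ)) := by
    intro p
    have hd : (dot p (y - x) : ℂ) = (dot p y : ℂ) - (dot p x : ℂ) := by
      rw [← Complex.ofReal_sub]
      congr 1
      simp only [dot, Pi.sub_apply, Int.cast_sub, mul_sub, Finset.sum_sub_distrib]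
    unfold planeWaveFun
    rw [inner_smul_left, inner_smul_right, inner_smul_left, inner_smul_right, hd, mul_sub,
      sub_eq_add_neg, Complex.exp_add, Complex.conj_ofReal, ← Complex.exp_conj, map_mul,
      Complex.conj_I, Complex.conj_ofReal, neg_mul]
    ring
  simp_rw [h1]
  rw [integral_const_mul, integral_exp_dot]
  by_cases h : x = y
  · rw [if_pos (by rw [h, sub_self]), if_pos h]
    linear_combination ⟪v, w⟫_ℂ * h2
  · rw [if_neg (fun hh => h (sub_eq_zero.mp hh).symm), if_neg h, mul_zero]

/-- The isometry `v ↦ (2π)^(-s/2) e^{i p·x} v` from `K` into `L²((-π, π]ˢ, K)`. -/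
def planeWave (x : Fin s → ℤ) : K →ₗᵢ[ℂ] Lp K 2 (momentumMeasure s) :=
  LinearMap.isometryOfInner
    { toFun := fun v => (planeWaveFun_memLp x v).toLp _
      map_add' := fun v w => by
        rw [← MemLp.toLp_add]
        congr 1
        funext p
        simp [planeWaveFun]
      map_smul' := fun c v => by
        rw [RingHom.id_apply, ← MemLp.toLp_const_smul]
        congr 1
        funext p
        simp only [planeWaveFun, Pi.smul_apply, smul_smul]
        congr 1
        ring }
    (fun v w => by
      rw [L2.inner_def]
      have := planeWaveFun_inner x x v w
      rw [if_pos rfl] at this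
      rw [← this]
      refine integral_congr_ae ?_
      filter_upwards [(planeWaveFun_memLp x v).coeFn_toLp, (planeWaveFun_memLp x w).coeFn_toLp]
        with p h1 h2
      simp only [LinearMap.coe_mk, AddHom.coe_mk]
      rw [h1, h2])

theorem planeWave_orthogonal :
    OrthogonalFamily ℂ (fun _ : Fin s → ℤ => K)
      (fun x => (planeWave x : K →ₗᵢ[ℂ] Lp K 2 (momentumMeasure s))) := by
  intro x y hxy v w
  have := planeWaveFun_inner x y v w
  rw [if_neg hxy] at this
  rw [L2.inner_def, ← this]
  refine integral_congr_ae ?_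
  filter_upwards [(planeWaveFun_memLp x v).coeFn_toLp, (planeWaveFun_memLp y w).coeFn_toLp]
    with p h1 h2

  exact congrArg₂ (fun a b => ⟪a, b⟫_ℂ) h1 h2

/-- The Fourier transform `(ℱψ)(p) = (2π)^(-s/2) ∑ₓ e^{i p·x} ψ(x)`, the sum being taken
in `L²((-π, π]ˢ, K)`. -/
def fourier [CompleteSpace K] : Space s K →ₗᵢ[ℂ] Lp K 2 (momentumMeasure s) :=
  planeWave_orthogonal.linearIsometry

end Fourier

/-! ## Bounded Borel functions and functional calculi -/

/-- Bounded Borel functions `ℝˢ → ℂ`. -/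
structure BoundedBorel (s : ℕ) where
  toFun : (Fin s → ℝ) → ℂ
  measurable : Measurable toFun
  bounded : ∃ C, ∀ v, ‖toFun v‖ ≤ C

/-- A continuous function vanishing at infinity, as a bounded Borel function. -/
def BoundedBorel.ofC0 {s : ℕ} (f : C₀(Fin s → ℝ, ℂ)) : BoundedBorel s where
  toFun := f
  measurable := f.continuous.measurable
  bounded := ⟨‖f.toBCF‖, fun v => f.toBCF.norm_coe_le_norm v⟩

/-- The indicator function `1_B` of a Borel set. -/
def BoundedBorel.indicator {s : ℕ} (B : Set (Fin s → ℝ)) (hB : MeasurableSet B) :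
    BoundedBorel s where
  toFun := B.indicator 1
  measurable := measurable_one.indicator hB
  bounded := ⟨1, fun v => by
    by_cases h : v ∈ B <;> simp [h]⟩

section Operators

variable {s : ℕ} {K : Type u} [NormedAddCommGroup K] [InnerProductSpace ℂ K]

theorem BoundedBorel.bound_nonneg (f : BoundedBorel s) : 0 ≤ f.bounded.choose :=
  (norm_nonneg _).trans (f.bounded.choose_spec 0)

/-- The bounded operator `f(Q / t)`, that is, `(f(Q / t) ψ)(x) = f(x / t) ψ(x)`. -/
def scaledPosition (t : ℕ) (f : BoundedBorel s) : Space s K →L[ℂ] Space s K :=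
  lp.mapCLM 2
    (fun x : Fin s → ℤ =>
      f.toFun (fun i => (x i : ℝ) / (t : ℝ)) • ContinuousLinearMap.id ℂ K)
    f.bound_nonneg
    (fun _ => (norm_smul_le _ _).trans
      ((mul_le_of_le_one_right (norm_nonneg _) ContinuousLinearMap.norm_id_le).trans
        (f.bounded.choose_spec _)))

/-- The joint functional calculus of a tuple `V = (V₁, …, Vₛ)` of commuting self-adjoint operators
on a finite-dimensional space: `f(V) = ∑ᵥ f(v) Eᵥ`, where `Eᵥ` is the orthogonal projection onto
the joint eigenspace `{u | V_α u = v_α u for all α}`, nonzero for finitely many `v ∈ ℝˢ`. -/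
def jointCalculus [FiniteDimensional ℂ K] (V : Fin s → K →L[ℂ] K) (f : BoundedBorel s) :
    K →L[ℂ] K :=
  ∑ᶠ v : Fin s → ℝ,
    f.toFun v • (⨅ α, Module.End.eigenspace (V α : K →ₗ[ℂ] K) (v α : ℂ)).starProjection

/-- The translation `(U_x ψ)(y) = ψ(y - x)`. -/
def translate (x : Fin s → ℤ) : Space s K →ₗᵢ[ℂ] Space s K where
  toFun ψ := ⟨fun y => ψ (y - x), by
    have h := (memℓp_gen_iff (by norm_num)).mp (lp.memℓp ψ)
    exact memℓp_gen ((Equiv.subRight x).summable_iff.mpr h)⟩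
  map_add' _ _ := rfl
  map_smul' _ _ := rfl
  norm_map' ψ := by
    rw [lp.norm_eq_tsum_rpow (by norm_num), lp.norm_eq_tsum_rpow (by norm_num)]
    congr 1
    exact (Equiv.subRight x).tsum_eq (fun y => ‖ψ y‖ ^ (2 : ℝ≥0∞).toReal)

end Operators

/-! ## Unitary quantum walks -/

/-- A unitary quantum walk on `ℤˢ` with internal space `K`: a unitary operator `W` on `ℓ²(ℤˢ, K)`
which commutes with translations and is such that `(Wψ)(x)` depends only on the values `ψ(y)` with
`x - y` in a fixed finite set. -/
structure QuantumWalk (s : ℕ) (K : Type u) [NormedAddCommGroup K] [InnerProductSpace ℂ K] where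
  unitary : Space s K ≃ₗᵢ[ℂ] Space s K
  neighborhood : Finset (Fin s → ℤ)
  commutes : ∀ x ψ, unitary (translate x ψ) = translate x (unitary ψ)
  finiteRange : ∀ (ψ φ : Space s K) (x : Fin s → ℤ),
    (∀ y, x - y ∈ neighborhood → ψ y = φ y) → unitary ψ x = unitary φ x

namespace QuantumWalk

variable {s : ℕ} {K : Type u} [NormedAddCommGroup K] [InnerProductSpace ℂ K]

/-- The momentum-space matrix `W(p) = ∑ₓ e^{i p·x} Wₓ`, where `Wₓ v = (W(δ₀ ⊗ v))(x)` and `x` runs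
over the neighborhood scheme. -/
def symbol (W : QuantumWalk s K) (p : Fin s → ℝ) : K →L[ℂ] K :=
  ∑ x ∈ W.neighborhood, Complex.exp (Complex.I * (dot p x : ℂ)) •
    ((lp.evalCLM ℂ (fun _ : Fin s → ℤ => K) 2 x).comp
      ((W.unitary.toContinuousLinearEquiv : Space s K →L[ℂ] Space s K).comp
        (lp.singleContinuousLinearMap ℂ (fun _ : Fin s → ℤ => K) 2 0)))

/-- A spectral resolution `W(q) = ∑ₖ e^{i ω_k(q)} P_k(q)` near `p` with `ω_k` and `P_k` real-analytic
functions of the vector `q`. -/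
structure AnalyticResolution (W : QuantumWalk s K) (p : Fin s → ℝ) where
  n : ℕ
  ω : Fin n → (Fin s → ℝ) → ℝ
  P : Fin n → (Fin s → ℝ) → (K →L[ℂ] K)
  analytic_ω : ∀ k, AnalyticAt ℝ (ω k) p
  analytic_P : ∀ k, AnalyticAt ℝ (P k) p
  symmetric : ∀ᶠ q in 𝓝 p, ∀ k, ((P k q : K →L[ℂ] K) : K →ₗ[ℂ] K).IsSymmetric
  idempotent : ∀ᶠ q in 𝓝 p, ∀ k, P k q * P k q = P k q
  orthogonal : ∀ᶠ q in 𝓝 p, ∀ j k, j ≠ k → P j q * P k q = 0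
  sum_eq_one : ∀ᶠ q in 𝓝 p, ∑ k, P k q = 1
  resolution : ∀ᶠ q in 𝓝 p,
    W.symbol q = ∑ k, Complex.exp (Complex.I * (ω k q : ℂ)) • P k q

/-- `p` is a regular momentum of the walk. -/
def IsRegular (W : QuantumWalk s K) (p : Fin s → ℝ) : Prop :=
  Nonempty (W.AnalyticResolution p)

open Classical in
/-- The components `V_α(p) = ∑ₖ (∂ω_k/∂p_α)(p) P_k(p)` of the group velocity operator at a regular
momentum `p` (and zero by convention at other momenta). The operator does not depend on the choice
of the analytic branches. -/
def groupVelocity (W : QuantumWalk s K) (p : Fin s → ℝ) (α : Fin s) : K →L[ℂ] K :=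
  if h : W.IsRegular p then
    ∑ k, ((fderiv ℝ (h.some.ω k) p (Pi.single α 1) : ℝ) : ℂ) • h.some.P k p
  else 0

/-- The operator `f(Q(t) / t) = W^{-t} f(Q / t) W^t`, where `Q(t) = W^{-t} Q W^t` is the position
observable evolved for `t` steps. -/
def evolvedPosition (W : QuantumWalk s K) (t : ℕ) (f : BoundedBorel s) :
    Space s K →L[ℂ] Space s K :=
  (((W.unitary ^ t).symm.toContinuousLinearEquiv : Space s K →L[ℂ] Space s K).comp
    (scaledPosition t f)).comp
      ((W.unitary ^ t).toContinuousLinearEquiv : Space s K →L[ℂ] Space s K)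

end QuantumWalk

/-! ## States -/

section States

variable {E : Type u} [NormedAddCommGroup E] [InnerProductSpace ℂ E]

/-- `tr T = c`: in every Hilbert basis the diagonal of `T` is summable with sum `c`. -/
def HasTrace (T : E →L[ℂ] E) (c : ℂ) : Prop :=
  ∀ {ι : Type u} (b : HilbertBasis ι ℂ E), HasSum (fun i => ⟪b i, T (b i)⟫_ℂ) c

/-- Density operators: positive operators of trace one. -/
def IsDensityOperator (ρ : E →L[ℂ] E) : Prop :=
  ρ.IsPositive ∧ HasTrace ρ 1

end States

end QW

end

/-! Everything is tested on the characters `v ↦ e^{i l·v}`. In momentum space `e^{i l·Q/t}` is the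
translation by `l/t`, so the matrix elements of `W^{-t} e^{i l·Q/t} W^t` between finitely supported
vectors with Fourier transforms `g` and `h` are the integrals of `⟨W(p)^t g(p), W(p + l/t)^t h(p +
l/t)⟩`. At a regular `p` the branch `k` contributes the phase `t (ω_k(p + l/t) - ω_k(p))`, a
difference quotient with limit `l·∇ω_k(p)`, while `P_k(p + l/t)` tends to `P_k(p)`. The integrand
therefore tends to that of `e^{i l·V}` (`tendsto_inner_symbol_pow`). Since the symbol is isometric
(`norm_symbol_apply`), dominated convergence applies, and density gives all vectors
(`tendsto_inner_evolvedPosition_character`).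

The same limit shows that `f(V)` is well defined. It depends on the symbol alone, so two choices of
analytic branches give the same `e^{i l·V(p)}`, and since characters separate points, the same
functions of `V(p)` (`sum_smul_eq`). One resolution serves a whole neighbourhood, so `f(V(p))` is
locally given by continuous branches; a countable cover makes it measurable, and surjectivity of the
Fourier transform brings the multiplication operator back to position space.

For distributions, every vector has a spectral measure with respect to `Q(t)/t` and `V`
(`IsSpectralCalculus`). With `S = √ρ` and a Hilbert basis `b`, the measures of the vectors `S bᵢ`
add up to the distribution in the state `ρ`; cyclicity of the trace (`hasSum_inner_sq_comp`)
identifies the sum with `tr(ρ ·)`. Lévy's continuity theorem turns convergence of characters into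
weak convergence (`tendsto_of_tendsto_character`). Functions in `C₀` follow from the case of unit
vectors by polarization. -/

noncomputable section

namespace QW

universe u

/-! ## Finite resolutions of the identity -/

section Resolution

variable {K : Type u} [NormedAddCommGroup K] [InnerProductSpace ℂ K]

/-- A finite family of mutually orthogonal orthogonal projections with sum one. -/
structure IsResolution {ι : Type*} [Fintype ι] (P : ι → K →L[ℂ] K) : Prop where
  symmetric : ∀ k, (P k : K →ₗ[ℂ] K).IsSymmetric
  idempotent : ∀ k, P k * P k = P k
  orthogonal : ∀ j k, j ≠ k → P j * P k = 0
  sum_eq_one : ∑ k, P k = 1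

namespace IsResolution

variable {ι κ : Type*} [Fintype ι] [Fintype κ] {P : ι → K →L[ℂ] K} {P' : κ → K →L[ℂ] K}

theorem inner_comm (h : IsResolution P) (k : ι) (u v : K) : ⟪P k u, v⟫_ℂ = ⟪u, P k v⟫_ℂ :=
  h.symmetric k u v

theorem mul_sum_smul (h : IsResolution P) (a : ι → ℂ) (k : ι) :
    P k * ∑ j, a j • P j = a k • P k := by
  rw [Finset.mul_sum, Finset.sum_eq_single k]
  · rw [mul_smul_comm, h.idempotent]
  · intro j _ hj
    rw [mul_smul_comm, h.orthogonal k j hj.symm, smul_zero]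
  · simp

theorem apply_sum_smul (h : IsResolution P) (a : ι → ℂ) (k : ι) (u : K) :
    P k ((∑ j, a j • P j) u) = a k • P k u := by
  have := congrArg (fun T : K →L[ℂ] K => T u) (h.mul_sum_smul a k)
  simpa using this

theorem sum_apply (h : IsResolution P) (u : K) : ∑ k, P k u = u := by
  have := congrArg (fun T : K →L[ℂ] K => T u) h.sum_eq_one
  simpa using this

theorem sum_smul_mul (h : IsResolution P) (a b : ι → ℂ) :
    (∑ k, a k • P k) * (∑ k, b k • P k) = ∑ k, (a k * b k) • P k := by
  rw [Finset.sum_mul]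
  refine Finset.sum_congr rfl fun k _ => ?_
  rw [smul_mul_assoc, h.mul_sum_smul, smul_smul]

theorem sum_smul_pow (h : IsResolution P) (a : ι → ℂ) (t : ℕ) :
    (∑ k, a k • P k) ^ t = ∑ k, a k ^ t • P k := by
  induction t with
  | zero => simp [h.sum_eq_one]
  | succ t ih => simp_rw [pow_succ, ih, h.sum_smul_mul]

theorem inner_sum_smul (h : IsResolution P) (a : ι → ℂ) (u : K) :
    ⟪u, (∑ k, a k • P k) u⟫_ℂ = ∑ k, ((‖P k u‖ ^ 2 : ℝ) : ℂ) * a k := by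
  simp only [_root_.sum_apply, smul_apply, inner_sum,
    inner_smul_right]
  refine Finset.sum_congr rfl fun k _ => ?_
  have : P k u = P k (P k u) := by
    conv_lhs => rw [← h.idempotent k]
    rfl
  rw [this, ← h.inner_comm, ← this, inner_self_eq_norm_sq_to_K, mul_comm]
  norm_cast

theorem sum_norm_sq (h : IsResolution P) (u : K) : ∑ k, ‖P k u‖ ^ 2 = ‖u‖ ^ 2 := by
  have := h.inner_sum_smul (fun _ => 1) u
  simp only [one_smul, h.sum_eq_one, mul_one, one_apply_eq_self] at this
  rw [inner_self_eq_norm_sq_to_K] at this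
  refine Complex.ofReal_injective ?_
  rw [Complex.ofReal_sum, ← this, Complex.ofReal_pow]
  rfl

/-- Pythagoras: the components in the ranges of the `P k` are orthogonal, and each is scaled by at
most `C`. -/
theorem norm_sum_smul_apply_le (h : IsResolution P) {a : ι → ℂ} {C : ℝ} (hC : 0 ≤ C)
    (ha : ∀ k, ‖a k‖ ≤ C) (u : K) : ‖(∑ k, a k • P k) u‖ ≤ C * ‖u‖ := by
  refine le_of_sq_le_sq ?_ (by positivity)
  rw [mul_pow, ← h.sum_norm_sq u, ← h.sum_norm_sq ((∑ k, a k • P k) u), Finset.mul_sum]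
  refine Finset.sum_le_sum fun k _ => ?_
  rw [h.apply_sum_smul, norm_smul, mul_pow]
  gcongr
  exact ha k

/-- Two spectral resolutions `∑ₖ χ(aₖ) Pₖ = ∑ⱼ χ(bⱼ) P'ⱼ` that agree for enough functions `χ` to
separate the values `aₖ ≠ bⱼ` agree for all functions. -/
theorem sum_smul_eq_of_separating (h : IsResolution P) (h' : IsResolution P') {X Λ : Type*}
    {a : ι → X} {b : κ → X} (χ : Λ → X → ℂ) (hχ : ∀ x y, x ≠ y → ∃ l, χ l x ≠ χ l y)
    (heq : ∀ l, ∑ k, χ l (a k) • P k = ∑ j, χ l (b j) • P' j) (F : X → ℂ) :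
    ∑ k, F (a k) • P k = ∑ j, F (b j) • P' j := by
  -- Either the two values coincide, or some `χ l` separates them; comparing `P k` times both
  -- expansions times `P' j` then forces `P k * P' j = 0`.
  have hz : ∀ k j, F (a k) • (P k * P' j) = F (b j) • (P k * P' j) := by
    intro k j
    by_cases hab : a k = b j
    · rw [hab]
    · obtain ⟨l, hl⟩ := hχ _ _ hab
      have h1 : χ l (a k) • (P k * P' j) = χ l (b j) • (P k * P' j) := by
        have h2 : P k * (∑ k, χ l (a k) • P k) * P' j =
            P k * ((∑ j, χ l (b j) • P' j) * P' j) := by rw [heq, mul_assoc]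
        rw [h.mul_sum_smul (fun k => χ l (a k)), smul_mul_assoc] at h2
        rw [h2, Finset.sum_mul, Finset.sum_eq_single j]
        · rw [smul_mul_assoc, h'.idempotent, mul_smul_comm]
        · intro i _ hi
          rw [smul_mul_assoc, h'.orthogonal i j hi, smul_zero]
        · simp
      have h3 : P k * P' j = 0 := by
        rw [← sub_eq_zero, ← sub_smul, smul_eq_zero] at h1
        exact h1.resolve_left (sub_ne_zero.mpr hl)
      rw [h3, smul_zero, smul_zero]
  calc ∑ k, F (a k) • P k = ∑ k, F (a k) • (P k * ∑ j, P' j) := by simp [h'.sum_eq_one]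
    _ = ∑ k, ∑ j, F (b j) • (P k * P' j) := by
        simp_rw [Finset.mul_sum, Finset.smul_sum, hz]
    _ = ∑ j, F (b j) • ((∑ k, P k) * P' j) := by
        rw [Finset.sum_comm]
        simp_rw [Finset.sum_mul, Finset.smul_sum]
    _ = ∑ j, F (b j) • P' j := by simp [h.sum_eq_one]

end IsResolution

variable {s : ℕ} {ι : Type*} [Fintype ι] {P : ι → K →L[ℂ] K}

open Classical in
-- Applying `P k` to the eigenvalue equations shows that a joint eigenvector for `v` has no
-- component in the range of `P k` unless `a k = v`. Distinct branches may share a value, hence the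
-- sum over a fibre of `a`.
theorem IsResolution.starProjection_iInf_eigenspace [FiniteDimensional ℂ K] (h : IsResolution P)
    (a : ι → Fin s → ℝ) (v : Fin s → ℝ) :
    (⨅ α, Module.End.eigenspace ((∑ k, (a k α : ℂ) • P k : K →L[ℂ] K) : K →ₗ[ℂ] K)
      (v α : ℂ)).starProjection = ∑ k with a k = v, P k := by
  have hE : ∑ k with a k = v, P k = ∑ k, (if a k = v then (1 : ℂ) else 0) • P k := by
    rw [Finset.sum_filter]
    exact Finset.sum_congr rfl fun k _ => by split_ifs <;> simp
  have hmem : ∀ w : K, w ∈ (⨅ α, Module.End.eigenspace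
      ((∑ k, (a k α : ℂ) • P k : K →L[ℂ] K) : K →ₗ[ℂ] K) (v α : ℂ)) ↔
      ∀ k, a k ≠ v → P k w = 0 := by
    intro w
    simp only [Submodule.mem_iInf, Module.End.mem_eigenspace_iff, ContinuousLinearMap.coe_coe]
    constructor
    · intro hw k hk
      obtain ⟨α, hα⟩ := Function.ne_iff.mp hk
      have h1 := congrArg (P k) (hw α)
      rw [h.apply_sum_smul (fun k => (a k α : ℂ)), map_smul, ← sub_eq_zero, ← sub_smul,
        smul_eq_zero] at h1
      refine h1.resolve_left (sub_ne_zero.mpr ?_)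
      exact_mod_cast hα
    · intro hw α
      conv_rhs => rw [← h.sum_apply w]
      rw [Finset.smul_sum, _root_.sum_apply]
      refine Finset.sum_congr rfl fun k _ => ?_
      by_cases hk : a k = v
      · rw [← hk]; rfl
      · simp [hw k hk]
  ext u
  refine Submodule.eq_starProjection_of_mem_of_inner_eq_zero ?_ ?_
  · rw [hmem]
    intro k hk
    rw [hE, h.apply_sum_smul, if_neg hk, zero_smul]
  · intro w hw
    rw [hmem] at hw
    have h1 : u - (∑ k with a k = v, P k) u = ∑ k with ¬ a k = v, P k u := by
      rw [sub_eq_iff_eq_add, _root_.sum_apply, add_comm,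
        Finset.sum_filter_add_sum_filter_not, h.sum_apply]
    rw [h1, sum_inner]
    refine Finset.sum_eq_zero fun k hk => ?_
    rw [h.inner_comm, hw k (Finset.mem_filter.mp hk).2, inner_zero_right]

theorem IsResolution.jointCalculus_eq [FiniteDimensional ℂ K] (h : IsResolution P)
    (a : ι → Fin s → ℝ) (f : BoundedBorel s) :
    jointCalculus (fun α => ∑ k, (a k α : ℂ) • P k) f = ∑ k, f.toFun (a k) • P k := by
  classical
  unfold jointCalculus
  simp_rw [h.starProjection_iInf_eigenspace a]
  -- A value `v` not attained by `a` has an empty fibre and so a zero projection.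
  rw [finsum_eq_sum_of_support_subset (s := Finset.univ.image a)]
  · rw [← Finset.sum_fiberwise_of_maps_to (g := a) (t := Finset.univ.image a)
      (fun k _ => Finset.mem_image_of_mem a (Finset.mem_univ k))]
    refine Finset.sum_congr rfl fun v _ => ?_
    rw [Finset.smul_sum]
    exact Finset.sum_congr rfl fun k hk => by rw [(Finset.mem_filter.mp hk).2]
  · intro v hv
    by_contra hv'
    refine hv ?_
    have : (Finset.univ.filter fun k => a k = v) = ∅ := by
      refine Finset.filter_eq_empty_iff.mpr fun k _ hk => hv' ?_
      exact Finset.mem_coe.mpr (Finset.mem_image.mpr ⟨k, Finset.mem_univ k, hk⟩)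
    simp [this]

end Resolution

/-! ## Characters of velocity space -/

/-- The character `v ↦ e^{i l·v}` as a bounded Borel function. -/
def BoundedBorel.character {s : ℕ} (l : Fin s → ℝ) : BoundedBorel s where
  toFun v := Complex.exp (Complex.I * ((∑ i, l i * v i : ℝ) : ℂ))
  measurable := by fun_prop
  bounded := ⟨1, fun v => by rw [mul_comm, Complex.norm_exp_ofReal_mul_I]⟩

theorem BoundedBorel.norm_character {s : ℕ} (l v : Fin s → ℝ) :
    ‖(BoundedBorel.character l).toFun v‖ = 1 := by
  simp only [BoundedBorel.character]
  rw [mul_comm, Complex.norm_exp_ofReal_mul_I]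

theorem BoundedBorel.character_separates {s : ℕ} {x y : Fin s → ℝ} (h : x ≠ y) :
    ∃ l, (BoundedBorel.character l).toFun x ≠ (BoundedBorel.character l).toFun y := by
  obtain ⟨i, hi⟩ := Function.ne_iff.mp h
  have hd : x i - y i ≠ 0 := sub_ne_zero.mpr hi
  -- With this `l` the quotient of the two character values is `e^{iπ} = -1`.
  refine ⟨Pi.single i (Real.pi / (x i - y i)), fun heq => ?_⟩
  simp only [BoundedBorel.character, Pi.single_apply, ite_mul, zero_mul, Finset.sum_ite_eq',
    Finset.mem_univ, if_true] at heq
  rw [← div_eq_one_iff_eq (Complex.exp_ne_zero _), ← Complex.exp_sub, ← mul_sub,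
    ← Complex.ofReal_sub, ← mul_sub, div_mul_cancel₀ _ hd, mul_comm, Complex.exp_pi_mul_I] at heq
  norm_num at heq

/-! ### Analytic branches and the group velocity -/

namespace QuantumWalk

variable {s : ℕ} {K : Type u} [NormedAddCommGroup K] [InnerProductSpace ℂ K]
  {W : QuantumWalk s K} {p : Fin s → ℝ}

namespace AnalyticResolution

theorem isResolution (R : W.AnalyticResolution p) :
    ∀ᶠ q in 𝓝 p, IsResolution fun k => R.P k q := by
  filter_upwards [R.symmetric, R.idempotent, R.orthogonal, R.sum_eq_one] with q h1 h2 h3 h4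
  exact ⟨h1, h2, h3, h4⟩

/-- The gradient of the branch `ω_k`. -/
def velocity (R : W.AnalyticResolution p) (k : Fin R.n) (q : Fin s → ℝ) : Fin s → ℝ :=
  fun α => fderiv ℝ (R.ω k) q (Pi.single α 1)

theorem fderiv_apply (R : W.AnalyticResolution p) (k : Fin R.n) (q l : Fin s → ℝ) :
    fderiv ℝ (R.ω k) q l = ∑ i, l i * R.velocity k q i := by
  have := (fderiv ℝ (R.ω k) q : (Fin s → ℝ) →ₗ[ℝ] ℝ).pi_apply_eq_sum_univ l
  simp only [ContinuousLinearMap.coe_coe, smul_eq_mul] at this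
  rw [this]
  refine Finset.sum_congr rfl fun i _ => ?_
  rw [velocity]
  congr 2
  ext j
  simp [Pi.single_apply, eq_comm]

/-- An analytic resolution at `p` is one at all nearby momenta, with the same branches. -/
theorem exists_of_eventually [FiniteDimensional ℂ K] (R : W.AnalyticResolution p) :
    ∀ᶠ q in 𝓝 p, ∃ R' : W.AnalyticResolution q, ∃ h : R'.n = R.n,
      (∀ k, R'.ω k = R.ω (Fin.cast h k)) ∧ ∀ k, R'.P k = R.P (Fin.cast h k) := by
  have : CompleteSpace K := FiniteDimensional.complete ℂ K
  have hω : ∀ᶠ q in 𝓝 p, ∀ k, AnalyticAt ℝ (R.ω k) q :=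
    eventually_all.mpr fun k => (R.analytic_ω k).eventually_analyticAt
  have hP : ∀ᶠ q in 𝓝 p, ∀ k, AnalyticAt ℝ (R.P k) q :=
    eventually_all.mpr fun k => (R.analytic_P k).eventually_analyticAt
  filter_upwards [hω, hP, R.symmetric.eventually_nhds, R.idempotent.eventually_nhds,
    R.orthogonal.eventually_nhds, R.sum_eq_one.eventually_nhds, R.resolution.eventually_nhds]
    with q h1 h2 h3 h4 h5 h6 h7
  exact ⟨⟨R.n, R.ω, R.P, h1, h2, h3, h4, h5, h6, h7⟩, rfl, fun _ => rfl, fun _ => rfl⟩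

/-- The neighbourhood is uniform in `t`, so the formula may be used at the moving point `q = p +
l/t`. -/
theorem symbol_pow (R : W.AnalyticResolution p) :
    ∀ᶠ q in 𝓝 p, ∀ t : ℕ,
      W.symbol q ^ t = ∑ k, Complex.exp (Complex.I * (t * R.ω k q : ℝ)) • R.P k q := by
  filter_upwards [R.isResolution, R.resolution] with q h1 h2 t
  rw [h2, h1.sum_smul_pow]
  refine Finset.sum_congr rfl fun k _ => ?_
  rw [← Complex.exp_nat_mul]
  congr 2
  push_cast
  ring

/-- At a regular momentum, `W(p)^{-t} W(p + l/t)^t` converges to `e^{i l·V(p)}`. -/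
theorem tendsto_inner_symbol_pow (R : W.AnalyticResolution p) (l : Fin s → ℝ) (u w : K)
    {w' : ℕ → K} (hw : Tendsto w' atTop (𝓝 w)) :
    Tendsto (fun t : ℕ => ⟪(W.symbol p ^ t) u, (W.symbol (p + (t : ℝ)⁻¹ • l) ^ t) (w' t)⟫_ℂ) atTop
      (𝓝 ⟪u, (∑ k, (BoundedBorel.character l).toFun (R.velocity k p) • R.P k p) w⟫_ℂ) := by
  have hq : Tendsto (fun t : ℕ => p + (t : ℝ)⁻¹ • l) atTop (𝓝 p) := by
    simpa using ((tendsto_inv_atTop_nhds_zero_nat (𝕜 := ℝ)).smul_const l).const_add p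
  have hres := R.isResolution.self_of_nhds
  have hpow := R.symbol_pow.self_of_nhds
  have hnorm : ∀ t : ℕ, ‖(W.symbol p ^ t) u‖ ≤ ‖u‖ := by
    intro t
    rw [hpow]
    refine (hres.norm_sum_smul_apply_le zero_le_one (fun k => ?_) u).trans_eq (one_mul _)
    rw [mul_comm, Complex.norm_exp_ofReal_mul_I]
  have hterm : ∀ (t : ℕ) (k : Fin R.n), ⟪(W.symbol p ^ t) u, R.P k p w⟫_ℂ =
      Complex.exp (-(Complex.I * (t * R.ω k p : ℝ))) * ⟪u, R.P k p w⟫_ℂ := by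
    intro t k
    rw [← hres.inner_comm, hpow, hres.apply_sum_smul, inner_smul_left, hres.inner_comm,
      ← Complex.exp_conj, map_mul, Complex.conj_I, Complex.conj_ofReal, neg_mul]
  -- The matrix element splits, branch by branch, into a phase given by a difference quotient of `ω
  -- k` and an error caused by the motion of `P k` and `w'`.
  have hev : ∀ᶠ t : ℕ in atTop,
      ∑ k, (Complex.exp (Complex.I * ((t : ℝ) * (R.ω k (p + (t : ℝ)⁻¹ • l) - R.ω k p) : ℝ)) *
          ⟪u, R.P k p w⟫_ℂ +
        Complex.exp (Complex.I * (t * R.ω k (p + (t : ℝ)⁻¹ • l) : ℝ)) *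
          ⟪(W.symbol p ^ t) u, R.P k (p + (t : ℝ)⁻¹ • l) (w' t) - R.P k p w⟫_ℂ) =
      ⟪(W.symbol p ^ t) u, (W.symbol (p + (t : ℝ)⁻¹ • l) ^ t) (w' t)⟫_ℂ := by
    filter_upwards [hq.eventually R.symbol_pow] with t ht
    rw [ht t, _root_.sum_apply, inner_sum]
    refine Finset.sum_congr rfl fun k _ => ?_
    have hexp : Complex.exp (Complex.I *
        ((t : ℝ) * (R.ω k (p + (t : ℝ)⁻¹ • l) - R.ω k p) : ℝ)) =
        Complex.exp (Complex.I * (t * R.ω k (p + (t : ℝ)⁻¹ • l) : ℝ)) *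
          Complex.exp (-(Complex.I * (t * R.ω k p : ℝ))) := by
      rw [← Complex.exp_add]
      congr 1
      push_cast
      ring
    rw [smul_apply, inner_smul_right, inner_sub_right, hterm, hexp]
    ring
  refine Tendsto.congr' hev ?_
  rw [_root_.sum_apply, inner_sum]
  refine tendsto_finsetSum _ fun k _ => ?_
  rw [smul_apply, inner_smul_right, ← add_zero (_ * _)]
  refine Tendsto.add (Tendsto.mul_const _ ?_) ?_
  · have h1 := ((R.analytic_ω k).differentiableAt.hasFDerivAt.lim_real l).comp
      tendsto_natCast_atTop_atTop (α := ℕ)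
    rw [R.fderiv_apply] at h1
    simp only [BoundedBorel.character]
    exact (Continuous.tendsto (by fun_prop : Continuous fun x : ℝ =>
      Complex.exp (Complex.I * (x : ℂ))) _).comp h1
  · have h2 : Tendsto (fun t : ℕ => R.P k (p + (t : ℝ)⁻¹ • l) (w' t) - R.P k p w) atTop (𝓝 0) := by
      have h3 := ((R.analytic_P k).continuousAt.tendsto.comp hq)
      have h4 := ((isBoundedBilinearMap_apply (𝕜 := ℂ) (E := K) (F := K)).continuous.tendsto
        (R.P k p, w)).comp (h3.prodMk_nhds hw)
      simpa using h4.sub_const (R.P k p w)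
    -- The phase has modulus one and `W(p)^t` does not increase norms, so the error is controlled by
    -- `P k (p + l/t) (w' t) - P k p w`.
    refine squeeze_zero_norm (a := fun t => ‖u‖ * _) (fun t => ?_)
      (by simpa using h2.norm.const_mul ‖u‖)
    rw [norm_mul, mul_comm Complex.I, Complex.norm_exp_ofReal_mul_I, one_mul]
    exact (norm_inner_le_norm _ _).trans (mul_le_mul_of_nonneg_right (hnorm t) (norm_nonneg _))

/-- Functions of the group velocity do not depend on the choice of the analytic branches. -/
theorem sum_smul_eq (R R' : W.AnalyticResolution p) (F : (Fin s → ℝ) → ℂ) :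
    ∑ k, F (R.velocity k p) • R.P k p = ∑ k, F (R'.velocity k p) • R'.P k p := by
  -- For characters both sides are limits of the same sequence, which involves only the symbol.
  refine R.isResolution.self_of_nhds.sum_smul_eq_of_separating R'.isResolution.self_of_nhds
    (fun l => (BoundedBorel.character l).toFun) (fun _ _ => BoundedBorel.character_separates)
    (fun l => ?_) F
  ext w
  refine ext_inner_left ℂ fun u => ?_
  exact tendsto_nhds_unique (R.tendsto_inner_symbol_pow l u w tendsto_const_nhds)
    (R'.tendsto_inner_symbol_pow l u w tendsto_const_nhds)

/-- The joint functional calculus of the group velocity in terms of any analytic resolution. -/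
theorem jointCalculus_groupVelocity [FiniteDimensional ℂ K] (R : W.AnalyticResolution p)
    (f : BoundedBorel s) :
    jointCalculus (W.groupVelocity p) f = ∑ k, f.toFun (R.velocity k p) • R.P k p := by
  have h : W.IsRegular p := ⟨R⟩
  -- The given resolution is exchanged for the one chosen in `groupVelocity`.
  rw [sum_smul_eq R h.some, ← h.some.isResolution.self_of_nhds.jointCalculus_eq]
  congr 1
  funext α
  rw [groupVelocity, dif_pos h]
  rfl

end AnalyticResolution

end QuantumWalk

/-! ## The Fourier transform is unitary -/

section Torus

attribute [local instance] instMeasureSpaceUnitAddCircle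

/-- The section `(ℝ / ℤ)ˢ → (-π, π]ˢ` of the quotient map. -/
def torusSection (s : ℕ) (z : UnitAddTorus (Fin s)) : Fin s → ℝ :=
  (2 * Real.pi) • fun i => (AddCircle.equivIoc 1 (-1 / 2) (z i) : ℝ)

/-- The Haar probability measure is carried to Lebesgue measure on `(-1/2, 1/2]ˢ` and then scaled by
`2π`. This transports the completeness of the Fourier basis of the torus to the momentum cell. -/
theorem measurePreserving_torusSection (s : ℕ) :
    MeasurePreserving (torusSection s) volume
      (ENNReal.ofReal |((2 * Real.pi) ^ s)⁻¹| • momentumMeasure s) := by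
  have hpi : (2 * Real.pi : ℝ) ≠ 0 := by positivity
  have hS : MeasurableSet {y : Fin s → ℝ | ∀ i, y i ∈ Set.Ioc (-1 / 2 : ℝ) (-1 / 2 + 1)} :=
    MeasurableSet.univ_pi' fun _ => measurableSet_Ioc
  have hsc : Measurable fun y : Fin s → ℝ => (2 * Real.pi) • y := by fun_prop
  have h1 := UnitAddTorus.measurePreserving_equivPiIoc (fun _ : Fin s => (-1 / 2 : ℝ))
  have h2 : MeasurePreserving
      (Subtype.val : {y : Fin s → ℝ // ∀ i, y i ∈ Set.Ioc (-1 / 2 : ℝ) (-1 / 2 + 1)} → _)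
      (Measure.comap Subtype.val volume)
      (volume.restrict {y : Fin s → ℝ | ∀ i, y i ∈ Set.Ioc (-1 / 2 : ℝ) (-1 / 2 + 1)}) :=
    ⟨measurable_subtype_coe, map_comap_subtype_coe hS volume⟩
  have h3 : MeasurePreserving (fun y : Fin s → ℝ => (2 * Real.pi) • y)
      (volume.restrict {y : Fin s → ℝ | ∀ i, y i ∈ Set.Ioc (-1 / 2 : ℝ) (-1 / 2 + 1)})
      (ENNReal.ofReal |((2 * Real.pi) ^ s)⁻¹| • momentumMeasure s) := by
    refine ⟨hsc, ?_⟩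
    have hpre : {y : Fin s → ℝ | ∀ i, y i ∈ Set.Ioc (-1 / 2 : ℝ) (-1 / 2 + 1)} =
        (fun y : Fin s → ℝ => (2 * Real.pi) • y) ⁻¹'
          (Set.univ.pi fun _ => Set.Ioc (-Real.pi) Real.pi) := by
      ext y
      simp only [Set.mem_ofPred_eq, Set.mem_preimage, Set.mem_univ_pi, Set.mem_Ioc, Pi.smul_apply,
        smul_eq_mul]
      refine forall_congr' fun i => ?_
      have := Real.pi_pos
      constructor
      · rintro ⟨ha, hb⟩
        constructor <;> nlinarith
      · rintro ⟨ha, hb⟩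
        constructor
        · by_contra hc
          nlinarith
        · by_contra hc
          nlinarith
    rw [hpre, ← Measure.restrict_map hsc (MeasurableSet.univ_pi fun _ => measurableSet_Ioc),
      Measure.map_addHaar_smul volume hpi, Measure.restrict_smul, Module.finrank_fin_fun]
    rfl
  exact h3.comp (h2.comp h1)

theorem mFourier_neg_eq_exp {s : ℕ} (x : Fin s → ℤ) (z : UnitAddTorus (Fin s)) :
    UnitAddTorus.mFourier (-x) z = Complex.exp (-(Complex.I * (dot (torusSection s z) x : ℂ))) := by
  have h : ∀ i, z i = ((AddCircle.equivIoc 1 (-1 / 2) (z i) : ℝ) : AddCircle (1 : ℝ)) := fun i =>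
    ((AddCircle.equivIoc 1 (-1 / 2)).symm_apply_apply (z i)).symm
  simp only [UnitAddTorus.mFourier, ContinuousMap.coe_mk, dot, torusSection]
  rw [Complex.ofReal_sum, Finset.mul_sum, ← Finset.sum_neg_distrib, Complex.exp_sum]
  refine Finset.prod_congr rfl fun i _ => ?_
  conv_lhs => rw [h i]
  rw [fourier_coe_apply]
  congr 1
  simp only [Pi.neg_apply, Pi.smul_apply, smul_eq_mul]
  push_cast
  ring

/-- A square integrable function on the momentum cell with vanishing Fourier coefficients
vanishes. -/
theorem ae_eq_zero_of_integral_exp_eq_zero {s : ℕ} {g : (Fin s → ℝ) → ℂ} (hm : Measurable g)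
    (hg : MemLp g 2 (momentumMeasure s))
    (h : ∀ x : Fin s → ℤ,
      ∫ p, Complex.exp (-(Complex.I * (dot p x : ℂ))) * g p ∂momentumMeasure s = 0) :
    ∀ᵐ p ∂momentumMeasure s, g p = 0 := by
  have hφ := measurePreserving_torusSection s
  have hc : ENNReal.ofReal |((2 * Real.pi) ^ s)⁻¹| ≠ 0 := by
    rw [Ne, ENNReal.ofReal_eq_zero, not_le]
    positivity
  have hL : MemLp (g ∘ torusSection s) 2 volume :=
    (hg.smul_measure ENNReal.ofReal_ne_top).comp_measurePreserving hφ
  have hzero : hL.toLp _ = 0 := by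
    -- The coordinates in the Fourier basis are the integrals assumed to vanish, up to the scaling
    -- factor of the measure.
    refine (UnitAddTorus.mFourierBasis (d := Fin s)).repr.injective ?_
    rw [map_zero]
    ext x
    rw [UnitAddTorus.mFourierBasis_repr, UnitAddTorus.mFourierCoeff]
    have h1 : ∫ z, UnitAddTorus.mFourier (-x) z • (hL.toLp _ : _ → ℂ) z =
        ∫ z, (fun p => Complex.exp (-(Complex.I * (dot p x : ℂ))) * g p) (torusSection s z) := by
      refine integral_congr_ae ?_
      filter_upwards [hL.coeFn_toLp] with z hz
      rw [hz, mFourier_neg_eq_exp]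
      rfl
    have hms : Measurable fun p : Fin s → ℝ =>
        Complex.exp (-(Complex.I * (dot p x : ℂ))) * g p := by
      unfold dot
      fun_prop
    rw [h1, ← integral_map hφ.measurable.aemeasurable hms.aestronglyMeasurable, hφ.map_eq,
      integral_smul_measure, h]
    simp
  have h2 : ∀ᵐ z ∂volume, g (torusSection s z) = 0 := by
    have := hL.coeFn_toLp
    rw [hzero] at this
    filter_upwards [this, Lp.coeFn_zero ℂ 2 (volume : Measure (UnitAddTorus (Fin s)))]
      with z h1 h2
    rw [h2] at h1
    exact h1.symm
  rw [← ae_map_iff hφ.measurable.aemeasurable (p := fun p => g p = 0)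
    (measurableSet_eq_fun hm measurable_const), hφ.map_eq, Measure.ae_ennreal_smul_measure_iff hc] at h2
  exact h2

end Torus

section

variable {s : ℕ} {K : Type u} [NormedAddCommGroup K] [InnerProductSpace ℂ K]
  [FiniteDimensional ℂ K]

/-- The range is the closed span of the plane waves. A function `g` orthogonal to all of them has
scalar components `⟪v, g⟫` with vanishing Fourier coefficients; a finite orthonormal basis of `K`
then gives `g = 0` almost everywhere. -/
theorem fourier_surjective [CompleteSpace K] :
    Function.Surjective (fourier : Space s K →ₗᵢ[ℂ] Lp K 2 (momentumMeasure s)) := by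
  have hr : LinearMap.range (fourier : Space s K →ₗᵢ[ℂ] Lp K 2 (momentumMeasure s)).toLinearMap
      = ⊤ := by
    rw [fourier, planeWave_orthogonal.range_linearIsometry,
      Submodule.topologicalClosure_eq_top_iff, Submodule.eq_bot_iff]
    intro g hg
    have hcoef : ∀ (v : K), ∀ᵐ p ∂momentumMeasure s, ⟪v, g p⟫_ℂ = 0 := by
      intro v
      refine ae_eq_zero_of_integral_exp_eq_zero ?_ ?_ fun x => ?_
      · exact (stronglyMeasurable_const.inner (Lp.stronglyMeasurable g)).measurable
      · exact (Lp.memLp g).const_inner v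
      · have h1 : planeWave x v ∈ ⨆ y : Fin s → ℤ, LinearMap.range
            (planeWave y : K →ₗᵢ[ℂ] Lp K 2 (momentumMeasure s)).toLinearMap :=
          Submodule.mem_iSup_of_mem x ⟨v, rfl⟩
        have h2 := (Submodule.mem_orthogonal _ _).mp hg _ h1
        rw [L2.inner_def] at h2
        have h3 : ∫ p, ⟪planeWaveFun x v p, g p⟫_ℂ ∂momentumMeasure s = 0 := by
          rw [← h2]
          refine integral_congr_ae ?_
          filter_upwards [(planeWaveFun_memLp x v).coeFn_toLp] with p hp
          exact congrArg (fun a => ⟪a, g p⟫_ℂ) hp.symm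
        have h4 : ∀ p, ⟪planeWaveFun x v p, g p⟫_ℂ = (((2 * Real.pi) ^ (-(s : ℝ) / 2) : ℝ) : ℂ) *
            (Complex.exp (-(Complex.I * (dot p x : ℂ))) * ⟪v, g p⟫_ℂ) := by
          intro p
          rw [planeWaveFun, inner_smul_left, inner_smul_left, Complex.conj_ofReal,
            ← Complex.exp_conj, map_mul, Complex.conj_I, Complex.conj_ofReal, neg_mul]
        simp_rw [h4] at h3
        rw [integral_const_mul, mul_eq_zero] at h3
        refine h3.resolve_left ?_
        exact_mod_cast (by positivity : (0 : ℝ) < (2 * Real.pi) ^ (-(s : ℝ) / 2)).ne'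
    have hall : ∀ᵐ p ∂momentumMeasure s, ∀ i, ⟪stdOrthonormalBasis ℂ K i, g p⟫_ℂ = 0 :=
      ae_all_iff.mpr fun i => hcoef _
    rw [Lp.eq_zero_iff_ae_eq_zero]
    filter_upwards [hall] with p hp
    refine (stdOrthonormalBasis ℂ K).repr.injective ?_
    ext i
    rw [OrthonormalBasis.repr_apply_apply, hp]
    simp
  exact LinearMap.range_eq_top.mp hr

/-- The Fourier transform as a unitary operator. -/
def fourierEquiv [CompleteSpace K] : Space s K ≃ₗᵢ[ℂ] Lp K 2 (momentumMeasure s) :=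
  LinearIsometryEquiv.ofSurjective fourier fourier_surjective

end

/-! ## The operators `f(V)` -/

theorem BoundedBorel.norm_le {s : ℕ} (f : BoundedBorel s) (v : Fin s → ℝ) :
    ‖f.toFun v‖ ≤ f.bounded.choose := f.bounded.choose_spec v

theorem BoundedBorel.integrable {s : ℕ} (f : BoundedBorel s) (m : Measure (Fin s → ℝ))
    [IsFiniteMeasure m] : Integrable f.toFun m :=
  Integrable.of_bound f.measurable.aestronglyMeasurable _ (ae_of_all _ f.norm_le)

/-- `Φ` assigns operators to bounded Borel functions in such a way that each vector `ψ` has a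
spectral measure of mass `‖ψ‖²`. -/
def IsSpectralCalculus {s : ℕ} {E : Type*} [NormedAddCommGroup E] [InnerProductSpace ℂ E]
    (Φ : BoundedBorel s → E →L[ℂ] E) : Prop :=
  ∀ ψ : E, ∃ m : Measure (Fin s → ℝ), m Set.univ = ENNReal.ofReal (‖ψ‖ ^ 2) ∧
    ∀ f, ⟪ψ, Φ f ψ⟫_ℂ = ∫ v, f.toFun v ∂m

namespace QuantumWalk

variable {s : ℕ} {K : Type u} [NormedAddCommGroup K] [InnerProductSpace ℂ K]
  {W : QuantumWalk s K} {p : Fin s → ℝ}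

theorem AnalyticResolution.norm_jointCalculus_le [FiniteDimensional ℂ K]
    (R : W.AnalyticResolution p) (f : BoundedBorel s) :
    ‖jointCalculus (W.groupVelocity p) f‖ ≤ f.bounded.choose := by
  refine ContinuousLinearMap.opNorm_le_bound _ f.bound_nonneg fun u => ?_
  rw [R.jointCalculus_groupVelocity]
  exact R.isResolution.self_of_nhds.norm_sum_smul_apply_le f.bound_nonneg (fun k => f.norm_le _) u

/-- `groupVelocity` chooses a resolution separately at each momentum, with no regularity in the
choice. On `U` a single family of continuous branches can be used instead, by independence of the
choice. -/
theorem AnalyticResolution.exists_open [FiniteDimensional ℂ K] (R : W.AnalyticResolution p) :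
    ∃ U, IsOpen U ∧ p ∈ U ∧ (∀ k, ContinuousOn (R.P k) U) ∧
      (∀ k, ContinuousOn (R.velocity k) U) ∧
      ∀ q ∈ U, ∃ R' : W.AnalyticResolution q, ∃ h : R'.n = R.n,
        (∀ k, R'.ω k = R.ω (Fin.cast h k)) ∧ ∀ k, R'.P k = R.P (Fin.cast h k) := by
  have : CompleteSpace K := FiniteDimensional.complete ℂ K
  have hω : ∀ᶠ q in 𝓝 p, ∀ k, AnalyticAt ℝ (R.ω k) q :=
    eventually_all.mpr fun k => (R.analytic_ω k).eventually_analyticAt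
  have hP : ∀ᶠ q in 𝓝 p, ∀ k, AnalyticAt ℝ (R.P k) q :=
    eventually_all.mpr fun k => (R.analytic_P k).eventually_analyticAt
  obtain ⟨U, hU, hUo, hpU⟩ := eventually_nhds_iff.mp ((hω.and hP).and R.exists_of_eventually)
  refine ⟨U, hUo, hpU, fun k q hq => ((hU q hq).1.2 k).continuousAt.continuousWithinAt,
    fun k q hq => ?_, fun q hq => (hU q hq).2⟩
  have h1 : ContinuousAt (fderiv ℝ (R.ω k)) q := ((hU q hq).1.1 k).fderiv.continuousAt
  refine ContinuousAt.continuousWithinAt (continuousAt_pi.mpr fun α => ?_)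
  exact h1.clm_apply continuousAt_const

theorem AnalyticResolution.sum_cast {q : Fin s → ℝ} {M : Type*} [AddCommMonoid M]
    (R : W.AnalyticResolution p) (R' : W.AnalyticResolution q) (h : R'.n = R.n)
    (hω : ∀ k, R'.ω k = R.ω (Fin.cast h k)) (hP : ∀ k, R'.P k = R.P (Fin.cast h k))
    (G : (Fin s → ℝ) → (K →L[ℂ] K) → M) :
    ∑ k, G (R'.velocity k q) (R'.P k q) = ∑ k, G (R.velocity k q) (R.P k q) := by
  refine Fintype.sum_equiv (finCongr h) _ _ fun k => ?_
  have hv : R'.velocity k q = R.velocity (Fin.cast h k) q := by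
    funext α
    simp only [velocity, hω]
  rw [hv, hP, finCongr_apply]

/-- Countably many neighborhoods of regular momenta cover almost all of the momentum cell. -/
theorem exists_countable_cover (hreg : ∀ᵐ p ∂momentumMeasure s, W.IsRegular p)
    {U : (Fin s → ℝ) → Set (Fin s → ℝ)} (hU : ∀ p, W.IsRegular p → U p ∈ 𝓝 p) :
    ∃ t : Set (Fin s → ℝ), t.Countable ∧ (∀ p ∈ t, W.IsRegular p) ∧
      (momentumMeasure s).restrict (⋃ p : t, U p) = momentumMeasure s := by
  obtain ⟨t, hts, htc, hcov⟩ := TopologicalSpace.countable_cover_nhdsWithin (f := U)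
    (s := {p | W.IsRegular p}) fun p hp => mem_nhdsWithin_of_mem_nhds (hU p hp)
  refine ⟨t, htc, hts, Measure.restrict_eq_self_of_ae_mem ?_⟩
  filter_upwards [hreg] with p hp
  rw [← Set.biUnion_eq_iUnion t (fun p _ => U p)]
  exact hcov hp

/-- Near a regular momentum the function is a finite sum built from `f` and the continuous branches
of one resolution; countably many such neighbourhoods suffice. -/
theorem aestronglyMeasurable_jointCalculus [FiniteDimensional ℂ K]
    (hreg : ∀ᵐ p ∂momentumMeasure s, W.IsRegular p) (f : BoundedBorel s) :
    AEStronglyMeasurable (fun p => jointCalculus (W.groupVelocity p) f) (momentumMeasure s) := by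
  have hloc : ∀ p, ∃ U : Set (Fin s → ℝ), W.IsRegular p → U ∈ 𝓝 p ∧
      AEStronglyMeasurable (fun p => jointCalculus (W.groupVelocity p) f)
        ((momentumMeasure s).restrict U) := by
    intro p
    by_cases hp : W.IsRegular p
    · obtain ⟨R⟩ := hp
      obtain ⟨U, hUo, hpU, hP, hv, hR⟩ := R.exists_open
      refine ⟨U, fun _ => ⟨hUo.mem_nhds hpU, ?_⟩⟩
      have h1 : AEStronglyMeasurable (fun q => ∑ k, f.toFun (R.velocity k q) • R.P k q)
          ((momentumMeasure s).restrict U) := by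
        refine Finset.aestronglyMeasurable_fun_sum _ fun k _ => ?_
        have h2 : AEStronglyMeasurable (fun q => f.toFun (R.velocity k q))
            ((momentumMeasure s).restrict U) := (f.measurable.comp_aemeasurable
          ((hv k).aemeasurable hUo.measurableSet)).aestronglyMeasurable
        exact h2.smul ((hP k).aestronglyMeasurable hUo.measurableSet)
      refine h1.congr ?_
      filter_upwards [ae_restrict_mem hUo.measurableSet] with q hq
      obtain ⟨R', h, hω, hP'⟩ := hR q hq
      rw [R'.jointCalculus_groupVelocity]
      exact (R.sum_cast R' h hω hP' fun v P => f.toFun v • P).symm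
    · exact ⟨∅, fun h => absurd h hp⟩
  choose U hU using hloc
  obtain ⟨t, htc, htr, ht⟩ := exists_countable_cover hreg fun p hp => (hU p hp).1
  have := htc.to_subtype
  rw [← ht, aestronglyMeasurable_iUnion_iff]
  exact fun p => (hU p (htr p p.2)).2

open Classical in
/-- The distribution of the group velocity at the momentum `p` in the state `u`. -/
def velocityMeasure (W : QuantumWalk s K) (p : Fin s → ℝ) (u : K) : Measure (Fin s → ℝ) :=
  if h : W.IsRegular p then
    ∑ k, ENNReal.ofReal (‖h.some.P k p u‖ ^ 2) • Measure.dirac (h.some.velocity k p)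
  else 0

/-- The mass of `B` is `⟪u, 1_B(V(p)) u⟫`, and by `sum_smul_eq` this does not depend on the
resolution. -/
theorem AnalyticResolution.velocityMeasure_apply (R : W.AnalyticResolution p) (u : K)
    {B : Set (Fin s → ℝ)} (hB : MeasurableSet B) :
    W.velocityMeasure p u B =
      ∑ k, ENNReal.ofReal (‖R.P k p u‖ ^ 2) * B.indicator 1 (R.velocity k p) := by
  have hsum : ∀ R : W.AnalyticResolution p,
      ∑ k, ENNReal.ofReal (‖R.P k p u‖ ^ 2) * B.indicator 1 (R.velocity k p) =
      ENNReal.ofReal (RCLike.re ⟪u, (∑ k, (B.indicator 1 (R.velocity k p) : ℂ) • R.P k p) u⟫_ℂ) := by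
    intro R
    rw [R.isResolution.self_of_nhds.inner_sum_smul
      (fun k => (B.indicator 1 (R.velocity k p) : ℂ)), map_sum,
      ENNReal.ofReal_sum_of_nonneg]
    · refine Finset.sum_congr rfl fun k _ => ?_
      by_cases h : R.velocity k p ∈ B
      · simp [h, -Complex.ofReal_pow]
      · simp [h]
    · intro k _
      by_cases h : R.velocity k p ∈ B
      · simp [h, -Complex.ofReal_pow]
      · simp [h]
  have h : W.IsRegular p := ⟨R⟩
  rw [hsum R, R.sum_smul_eq h.some, ← hsum h.some, velocityMeasure, dif_pos h]
  simp [hB, Measure.dirac_apply']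

theorem AnalyticResolution.velocityMeasure_univ (R : W.AnalyticResolution p) (u : K) :
    W.velocityMeasure p u Set.univ = ENNReal.ofReal (‖u‖ ^ 2) := by
  rw [R.velocityMeasure_apply u MeasurableSet.univ, ← R.isResolution.self_of_nhds.sum_norm_sq u,
    ENNReal.ofReal_sum_of_nonneg fun _ _ => by positivity]
  simp

theorem integral_velocityMeasure [FiniteDimensional ℂ K] (h : W.IsRegular p) (u : K)
    (f : BoundedBorel s) :
    ∫ v, f.toFun v ∂W.velocityMeasure p u = ⟪u, jointCalculus (W.groupVelocity p) f u⟫_ℂ := by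
  rw [h.some.jointCalculus_groupVelocity, h.some.isResolution.self_of_nhds.inner_sum_smul
    (fun k => f.toFun (h.some.velocity k p)), velocityMeasure, dif_pos h,
    integral_finsetSum_measure]
  · refine Finset.sum_congr rfl fun k _ => ?_
    rw [integral_smul_measure, integral_dirac, ENNReal.toReal_ofReal (by positivity),
      Complex.real_smul]
  · intro k _
    exact (f.integrable _).smul_measure ENNReal.ofReal_ne_top

theorem aemeasurable_velocityMeasure [FiniteDimensional ℂ K]
    (hreg : ∀ᵐ p ∂momentumMeasure s, W.IsRegular p) {u : (Fin s → ℝ) → K}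
    (hu : AEStronglyMeasurable u (momentumMeasure s)) :
    AEMeasurable (fun p => W.velocityMeasure p (u p)) (momentumMeasure s) := by
  have hloc : ∀ p, ∃ U : Set (Fin s → ℝ), W.IsRegular p → U ∈ 𝓝 p ∧
      AEMeasurable (fun p => W.velocityMeasure p (u p)) ((momentumMeasure s).restrict U) := by
    intro p
    by_cases hp : W.IsRegular p
    · obtain ⟨R⟩ := hp
      obtain ⟨U, hUo, hpU, hP, hv, hR⟩ := R.exists_open
      refine ⟨U, fun _ => ⟨hUo.mem_nhds hpU, ?_⟩⟩
      have hvm : ∀ k, AEMeasurable (R.velocity k) ((momentumMeasure s).restrict U) := fun k =>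
        (hv k).aemeasurable hUo.measurableSet
      have hPm : ∀ k, AEMeasurable (fun q => ENNReal.ofReal (‖R.P k q (u q)‖ ^ 2))
          ((momentumMeasure s).restrict U) := fun k => by
        have h1 : AEStronglyMeasurable (fun q => R.P k q (u q)) ((momentumMeasure s).restrict U) :=
          isBoundedBilinearMap_apply.continuous.comp_aestronglyMeasurable
            (((hP k).aestronglyMeasurable hUo.measurableSet).prodMk hu.restrict)
        exact (h1.norm.aemeasurable.pow_const 2).ennreal_ofReal
      -- Weights and atoms are replaced by measurable representatives, which agree with them almost
      -- everywhere on `U`.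
      refine ⟨fun q => ∑ k, (hPm k).mk _ q • Measure.dirac ((hvm k).mk _ q), ?_, ?_⟩
      · refine Measure.measurable_of_measurable_coe _ fun B hB => ?_
        simp only [Measure.coe_finsetSum, Finset.sum_apply, Measure.smul_apply, smul_eq_mul,
          Measure.dirac_apply' _ hB]
        refine Finset.measurable_fun_sum _ fun k _ => ?_
        exact (hPm k).measurable_mk.mul
          ((measurable_one.indicator hB).comp (hvm k).measurable_mk)
      · filter_upwards [ae_restrict_mem hUo.measurableSet,
          ae_all_iff.mpr fun k => (hPm k).ae_eq_mk, ae_all_iff.mpr fun k => (hvm k).ae_eq_mk]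
          with q hq h1 h2
        simp_rw [← h1, ← h2]
        obtain ⟨R', h, hω, hP'⟩ := hR q hq
        ext B hB
        rw [R'.velocityMeasure_apply _ hB, R.sum_cast R' h hω hP' fun v P =>
          ENNReal.ofReal (‖P (u q)‖ ^ 2) * B.indicator 1 v]
        simp [hB, Measure.dirac_apply']
    · exact ⟨∅, fun h => absurd h hp⟩
  choose U hU using hloc
  obtain ⟨t, htc, htr, ht⟩ := exists_countable_cover hreg fun p hp => (hU p hp).1
  have := htc.to_subtype
  rw [← ht, aemeasurable_iUnion_iff]
  exact fun p => (hU p (htr p p.2)).2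

theorem memLp_jointCalculus [FiniteDimensional ℂ K] (hreg : ∀ᵐ p ∂momentumMeasure s, W.IsRegular p)
    (f : BoundedBorel s) :
    MemLp (fun p => jointCalculus (W.groupVelocity p) f) ∞ (momentumMeasure s) :=
  memLp_top_of_bound (aestronglyMeasurable_jointCalculus hreg f) f.bounded.choose
    (hreg.mono fun _ h => h.some.norm_jointCalculus_le f)

variable [CompleteSpace K] [FiniteDimensional ℂ K]

/-- The operator `f(V)`: multiplication by `f(V(p))` in momentum space. -/
def velocityCalculus (hreg : ∀ᵐ p ∂momentumMeasure s, W.IsRegular p) (f : BoundedBorel s) :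
    Space s K →L[ℂ] Space s K :=
  (((fourierEquiv (s := s) (K := K)).symm.toContinuousLinearEquiv :
      Lp K 2 (momentumMeasure s) →L[ℂ] Space s K).comp
    ((ContinuousLinearMap.id ℂ (K →L[ℂ] K)).holderL (momentumMeasure s) ∞ 2 2
      ((memLp_jointCalculus hreg f).toLp _))).comp
    (fourier (s := s) (K := K)).toContinuousLinearMap

theorem fourier_velocityCalculus (hreg : ∀ᵐ p ∂momentumMeasure s, W.IsRegular p)
    (f : BoundedBorel s) (ψ : Space s K) :
    fourier (velocityCalculus hreg f ψ) =ᵐ[momentumMeasure s]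
      fun p => jointCalculus (W.groupVelocity p) f (fourier ψ p) := by
  have h1 : fourier (velocityCalculus hreg f ψ) = (ContinuousLinearMap.id ℂ (K →L[ℂ] K)).holder 2
      ((memLp_jointCalculus hreg f).toLp _) (fourier ψ) :=
    (fourierEquiv (s := s) (K := K)).apply_symm_apply _
  rw [h1]
  filter_upwards [(ContinuousLinearMap.id ℂ (K →L[ℂ] K)).coeFn_holder (r := 2)
      ((memLp_jointCalculus hreg f).toLp _) (fourier ψ),
    (memLp_jointCalculus hreg f).coeFn_toLp] with p h2 h3
  rw [h2, h3]
  rfl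

theorem inner_velocityCalculus (hreg : ∀ᵐ p ∂momentumMeasure s, W.IsRegular p)
    (f : BoundedBorel s) (φ ψ : Space s K) :
    ⟪φ, velocityCalculus hreg f ψ⟫_ℂ =
      ∫ p, ⟪fourier φ p, jointCalculus (W.groupVelocity p) f (fourier ψ p)⟫_ℂ
        ∂momentumMeasure s := by
  rw [← (fourier : Space s K →ₗᵢ[ℂ] _).inner_map_map, L2.inner_def]
  refine integral_congr_ae ?_
  filter_upwards [fourier_velocityCalculus hreg f ψ] with p hp
  rw [hp]

open ProbabilityTheory in
-- The spectral measure of `ψ` is the mixture over `p` of the distributions of `V(p)` in the vectors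
-- `(ℱψ)(p)`. Its mass is `‖ℱψ‖² = ‖ψ‖²`.
theorem isSpectralCalculus_velocityCalculus
    (hreg : ∀ᵐ p ∂momentumMeasure s, W.IsRegular p) :
    IsSpectralCalculus (velocityCalculus hreg) := by
  intro ψ
  have hm := aemeasurable_velocityMeasure hreg (Lp.stronglyMeasurable
    (fourier ψ)).aestronglyMeasurable
  let κ : Kernel (Fin s → ℝ) (Fin s → ℝ) := ⟨hm.mk _, hm.measurable_mk⟩
  have hκ : ∀ᵐ p ∂momentumMeasure s, κ p = W.velocityMeasure p (fourier ψ p) :=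
    hm.ae_eq_mk.symm
  have huniv : (momentumMeasure s).bind κ Set.univ = ENNReal.ofReal (‖ψ‖ ^ 2) := by
    rw [Measure.bind_apply MeasurableSet.univ κ.measurable.aemeasurable]
    have h1 : ∫⁻ p, κ p Set.univ ∂momentumMeasure s =
        ∫⁻ p, ENNReal.ofReal (‖fourier ψ p‖ ^ 2) ∂momentumMeasure s := by
      refine lintegral_congr_ae ?_
      filter_upwards [hκ, hreg] with p h1 h2
      rw [h1, h2.some.velocityMeasure_univ]
    have h2 : Integrable (fun p => ‖fourier ψ p‖ ^ 2) (momentumMeasure s) :=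
      (Lp.memLp (fourier ψ)).integrable_norm_pow two_ne_zero
    rw [h1, ← ofReal_integral_eq_lintegral_ofReal h2 (ae_of_all _ fun _ => by positivity),
      ← (fourier : Space s K →ₗᵢ[ℂ] _).norm_map ψ]
    congr 1
    have h3 := L2.inner_def (𝕜 := ℂ) (fourier ψ) (fourier ψ)
    simp_rw [inner_self_eq_norm_sq_to_K] at h3
    refine Complex.ofReal_injective ?_
    rw [← integral_complex_ofReal, Complex.ofReal_pow]
    refine Eq.trans ?_ h3.symm
    exact integral_congr_ae (ae_of_all _ fun p => Complex.ofReal_pow _ _)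
  have : IsFiniteMeasure ((momentumMeasure s).bind κ) :=
    ⟨by rw [huniv]; exact ENNReal.ofReal_lt_top⟩
  refine ⟨(momentumMeasure s).bind κ, huniv, fun f => ?_⟩
  have hf := f.integrable ((momentumMeasure s).bind κ)
  -- Written as a composition with a constant kernel, the mixture can be integrated fibrewise.
  rw [Measure.comp_eq_comp_const_apply] at hf ⊢
  rw [Kernel.integral_comp hf, Kernel.const_apply, inner_velocityCalculus]
  refine integral_congr_ae ?_
  filter_upwards [hκ, hreg] with p h1 h2
  rw [h1, integral_velocityMeasure h2]

end QuantumWalk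

/-! ## Quantum walks on finitely supported vectors -/

section

variable {s : ℕ} {K : Type u} [NormedAddCommGroup K] [InnerProductSpace ℂ K]

theorem translate_single (x : Fin s → ℤ) (v : K) :
    translate x (lp.single 2 0 v : Space s K) = lp.single 2 x v := by
  ext y
  change (lp.single 2 0 v : Space s K) (y - x) = _
  by_cases h : y = x
  · subst h
    rw [sub_self, lp.single_apply_self, lp.single_apply_self]
  · rw [lp.single_apply_ne _ _ _ (sub_ne_zero.mpr h), lp.single_apply_ne _ _ _ h]

theorem scaledPosition_apply (t : ℕ) (f : BoundedBorel s) (ψ : Space s K) (x : Fin s → ℤ) :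
    scaledPosition t f ψ x = f.toFun (fun i => (x i : ℝ) / (t : ℝ)) • ψ x := rfl

theorem norm_scaledPosition_le (t : ℕ) {f : BoundedBorel s} {C : ℝ} (hC : 0 ≤ C)
    (hf : ∀ v, ‖f.toFun v‖ ≤ C) :
    ‖(scaledPosition t f : Space s K →L[ℂ] Space s K)‖ ≤ C := by
  refine (lp.norm_mapCLM_le (K := C) 2 _ hC fun x => ?_)
  exact (norm_smul_le _ _).trans ((mul_le_of_le_one_right (norm_nonneg _)
    ContinuousLinearMap.norm_id_le).trans (hf _))

theorem scaledPosition_character_single (t : ℕ) (l : Fin s → ℝ) (x : Fin s → ℤ) (v : K) :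
    scaledPosition t (BoundedBorel.character l) (lp.single 2 x v : Space s K) =
      lp.single 2 x (Complex.exp (Complex.I * (dot ((t : ℝ)⁻¹ • l) x : ℂ)) • v) := by
  ext y
  rw [scaledPosition_apply]
  by_cases h : y = x
  · subst h
    rw [lp.single_apply_self, lp.single_apply_self]
    simp only [BoundedBorel.character, dot, Pi.smul_apply, smul_eq_mul]
    congr 5
    funext i
    ring
  · rw [lp.single_apply_ne _ _ _ h, lp.single_apply_ne _ _ _ h, smul_zero]

theorem planeWaveFun_add (x : Fin s → ℤ) (v : K) (p a : Fin s → ℝ) :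
    planeWaveFun x v (p + a) =
      planeWaveFun x (Complex.exp (Complex.I * (dot a x : ℂ)) • v) p := by
  have : dot (p + a) x = dot p x + dot a x := by
    simp [dot, add_mul, Finset.sum_add_distrib]
  rw [planeWaveFun, planeWaveFun, this, Complex.ofReal_add, mul_add, Complex.exp_add, mul_smul]

/-- The finitely supported vectors, paired with their Fourier transforms as functions on `ℝˢ`. -/
def trigonometric (s : ℕ) (K : Type u) [NormedAddCommGroup K] [InnerProductSpace ℂ K] :
    Submodule ℂ (Space s K × ((Fin s → ℝ) → K)) :=
  Submodule.span ℂ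
    (Set.range fun xv : (Fin s → ℤ) × K => (lp.single 2 xv.1 xv.2, planeWaveFun xv.1 xv.2))

theorem single_mem_trigonometric (x : Fin s → ℤ) (v : K) :
    (lp.single 2 x v, planeWaveFun x v) ∈ trigonometric s K :=
  Submodule.subset_span ⟨(x, v), rfl⟩

theorem sum_single_mem_trigonometric (F : Finset (Fin s → ℤ)) (x : (Fin s → ℤ) → Fin s → ℤ)
    (v : (Fin s → ℤ) → K) :
    ((∑ z ∈ F, lp.single 2 (x z) (v z) : Space s K), ∑ z ∈ F, planeWaveFun (x z) (v z)) ∈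
      trigonometric s K := by
  have h := Submodule.sum_mem (trigonometric s K)
    fun z (_ : z ∈ F) => single_mem_trigonometric (x z) (v z)
  have e : ∑ z ∈ F, ((lp.single 2 (x z) (v z) : Space s K), planeWaveFun (x z) (v z)) =
      (∑ z ∈ F, lp.single 2 (x z) (v z), ∑ z ∈ F, planeWaveFun (x z) (v z)) :=
    Prod.ext Prod.fst_sum Prod.snd_sum
  exact e ▸ h

theorem map_mem_trigonometric
    (L : (Space s K × ((Fin s → ℝ) → K)) →ₗ[ℂ] (Space s K × ((Fin s → ℝ) → K)))
    (hL : ∀ x v, L (lp.single 2 x v, planeWaveFun x v) ∈ trigonometric s K)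
    {χ : Space s K × ((Fin s → ℝ) → K)} (h : χ ∈ trigonometric s K) :
    L χ ∈ trigonometric s K := by
  have : trigonometric s K ≤ (trigonometric s K).comap L := by
    refine Submodule.span_le.mpr ?_
    rintro _ ⟨⟨x, v⟩, rfl⟩
    exact hL x v
  exact this h

/-- The multiplier `e^{i l·Q/t}` translates momentum by `l/t`. This leaves the momentum cell, which
is why transforms are kept as functions on all of `ℝˢ`. -/
theorem shift_mem_trigonometric (t : ℕ) (l : Fin s → ℝ) {χ : Space s K} {g : (Fin s → ℝ) → K}
    (h : (χ, g) ∈ trigonometric s K) :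
    (scaledPosition t (BoundedBorel.character l) χ, fun p => g (p + (t : ℝ)⁻¹ • l)) ∈
      trigonometric s K := by
  refine map_mem_trigonometric (LinearMap.prodMap
    (scaledPosition t (BoundedBorel.character l) : Space s K →L[ℂ] Space s K).toLinearMap
    (LinearMap.funLeft ℂ K fun p => p + (t : ℝ)⁻¹ • l)) (fun x v => ?_) h
  have : LinearMap.funLeft ℂ K (fun p => p + (t : ℝ)⁻¹ • l) (planeWaveFun x v) = planeWaveFun x
      (Complex.exp (Complex.I * (dot ((t : ℝ)⁻¹ • l) x : ℂ)) • v) := by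
    funext p
    exact planeWaveFun_add x v p _
  rw [LinearMap.prodMap_apply, this]
  simp only [ContinuousLinearMap.coe_coe, scaledPosition_character_single]
  exact single_mem_trigonometric _ _

theorem trigonometric_continuous {χ : Space s K} {g : (Fin s → ℝ) → K}
    (h : (χ, g) ∈ trigonometric s K) : Continuous g := by
  refine Submodule.span_induction (p := fun χ _ => Continuous χ.2) ?_ continuous_const
    (fun _ _ _ _ h1 h2 => h1.add h2) (fun c _ _ h1 => h1.const_smul c) h
  rintro _ ⟨⟨x, v⟩, rfl⟩
  exact planeWaveFun_continuous x v

theorem trigonometric_bounded {χ : Space s K} {g : (Fin s → ℝ) → K}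
    (h : (χ, g) ∈ trigonometric s K) : ∃ C, ∀ p, ‖g p‖ ≤ C := by
  refine Submodule.span_induction (p := fun χ _ => ∃ C, ∀ p, ‖χ.2 p‖ ≤ C) ?_
    ⟨0, fun _ => norm_zero.le⟩ ?_ ?_ h
  · rintro _ ⟨⟨x, v⟩, rfl⟩
    exact ⟨_, fun p => (planeWaveFun_norm x v p).le⟩
  · rintro _ _ _ _ ⟨C, hC⟩ ⟨D, hD⟩
    exact ⟨C + D, fun p => (norm_add_le _ _).trans (add_le_add (hC p) (hD p))⟩
  · rintro c _ _ ⟨C, hC⟩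
    exact ⟨‖c‖ * C, fun p => (norm_smul_le _ _).trans
      (mul_le_mul_of_nonneg_left (hC p) (norm_nonneg c))⟩

theorem fourier_single_ae [CompleteSpace K] (x : Fin s → ℤ) (v : K) :
    fourier (lp.single 2 x v : Space s K) =ᵐ[momentumMeasure s] planeWaveFun x v := by
  have h1 : fourier (lp.single 2 x v : Space s K) = planeWave x v :=
    planeWave_orthogonal.linearIsometry_apply_single v
  rw [h1]
  exact (planeWaveFun_memLp x v).coeFn_toLp

theorem fourier_ae_add [CompleteSpace K] {χ₁ χ₂ : Space s K} {g₁ g₂ : (Fin s → ℝ) → K}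
    (h₁ : fourier χ₁ =ᵐ[momentumMeasure s] g₁) (h₂ : fourier χ₂ =ᵐ[momentumMeasure s] g₂) :
    fourier (χ₁ + χ₂) =ᵐ[momentumMeasure s] g₁ + g₂ := by
  rw [map_add]
  exact (Lp.coeFn_add _ _).trans (h₁.add h₂)

theorem fourier_ae_smul [CompleteSpace K] (c : ℂ) {χ : Space s K} {g : (Fin s → ℝ) → K}
    (h : fourier χ =ᵐ[momentumMeasure s] g) :
    fourier (c • χ) =ᵐ[momentumMeasure s] c • g := by
  rw [map_smul]
  exact (Lp.coeFn_smul _ _).trans (h.const_smul c)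

theorem fourier_ae_zero [CompleteSpace K] :
    fourier (0 : Space s K) =ᵐ[momentumMeasure s] 0 := by
  rw [map_zero]
  exact Lp.coeFn_zero _ _ _

theorem trigonometric_fourier [CompleteSpace K] {χ : Space s K} {g : (Fin s → ℝ) → K}
    (h : (χ, g) ∈ trigonometric s K) : fourier χ =ᵐ[momentumMeasure s] g := by
  have key : trigonometric s K ≤
      { carrier := {χ | fourier χ.1 =ᵐ[momentumMeasure s] χ.2}
        add_mem' := fun h₁ h₂ => fourier_ae_add h₁ h₂
        zero_mem' := fourier_ae_zero
        smul_mem' := fun c _ h => fourier_ae_smul c h } := by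
    rw [trigonometric, Submodule.span_le]
    intro χ hχ
    obtain ⟨xv, rfl⟩ := hχ
    exact fourier_single_ae xv.1 xv.2
  exact key h

theorem exists_trigonometric_norm_sub_lt (ψ : Space s K) {ε : ℝ} (hε : 0 < ε) :
    ∃ χ g, (χ, g) ∈ trigonometric s K ∧ ‖ψ - χ‖ < ε := by
  have h1 := lp.hasSum_single (p := 2) (by norm_num) ψ
  obtain ⟨F, hF⟩ := (Metric.tendsto_nhds.mp h1 ε hε).exists
  refine ⟨∑ x ∈ F, lp.single 2 x (ψ x), ∑ x ∈ F, planeWaveFun x (ψ x), ?_, ?_⟩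
  · exact sum_single_mem_trigonometric F id ψ
  · rwa [dist_comm, dist_eq_norm] at hF

end

/-! ### The walk in momentum space and the limit for characters -/

namespace QuantumWalk

variable {s : ℕ} {K : Type u} [NormedAddCommGroup K] [InnerProductSpace ℂ K]
  (W : QuantumWalk s K)

/-- The operators `Wₓ` on the internal space. -/
def coin (x : Fin s → ℤ) : K →L[ℂ] K :=
  (lp.evalCLM ℂ (fun _ : Fin s → ℤ => K) 2 x).comp
      ((W.unitary.toContinuousLinearEquiv : Space s K →L[ℂ] Space s K).comp
        (lp.singleContinuousLinearMap ℂ (fun _ : Fin s → ℤ => K) 2 0))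

theorem coin_apply (x : Fin s → ℤ) (v : K) : W.coin x v = W.unitary (lp.single 2 0 v) x := rfl

theorem symbol_apply (p : Fin s → ℝ) (v : K) : W.symbol p v =
    ∑ x ∈ W.neighborhood, Complex.exp (Complex.I * (dot p x : ℂ)) • W.coin x v := by
  rw [symbol, _root_.sum_apply]
  rfl

theorem symbol_continuous : Continuous W.symbol := by
  unfold symbol dot
  fun_prop

theorem coin_eq_zero {x : Fin s → ℤ} (hx : x ∉ W.neighborhood) : W.coin x = 0 := by
  ext v
  rw [coin_apply, W.finiteRange (lp.single 2 0 v) 0 x, map_zero]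
  · rfl
  · intro y hy
    rw [lp.single_apply_ne]
    · rfl
    · rintro rfl
      exact hx (by simpa using hy)

theorem unitary_single_apply (x y : Fin s → ℤ) (v : K) :
    W.unitary (lp.single 2 x v) y = W.coin (y - x) v := by
  rw [← translate_single, W.commutes, coin_apply]
  rfl

theorem unitary_single (x : Fin s → ℤ) (v : K) :
    W.unitary (lp.single 2 x v) = ∑ z ∈ W.neighborhood, lp.single 2 (x + z) (W.coin z v) := by
  ext y
  rw [unitary_single_apply, lp.coeFn_sum, Finset.sum_apply]
  by_cases h : y - x ∈ W.neighborhood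
  · rw [Finset.sum_eq_single (y - x)]
    · rw [add_sub_cancel, lp.single_apply_self]
    · intro z _ hz
      rw [lp.single_apply_ne]
      rintro rfl
      exact hz (by abel)
    · exact fun h' => absurd h h'
  · rw [W.coin_eq_zero h, Finset.sum_eq_zero]
    · rfl
    · intro z hz
      rw [lp.single_apply_ne]
      rintro rfl
      exact h (by simpa using hz)

theorem symbol_planeWaveFun (x : Fin s → ℤ) (v : K) (p : Fin s → ℝ) :
    W.symbol p (planeWaveFun x v p) =
      ∑ z ∈ W.neighborhood, planeWaveFun (x + z) (W.coin z v) p := by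
  rw [symbol_apply]
  refine Finset.sum_congr rfl fun z _ => ?_
  have : dot p (x + z) = dot p x + dot p z := by
    simp [dot, mul_add, Finset.sum_add_distrib]
  rw [planeWaveFun, planeWaveFun, this, Complex.ofReal_add, mul_add, Complex.exp_add, map_smul,
    map_smul, smul_smul, smul_smul, smul_smul]
  congr 1
  ring

theorem walk_mem_trigonometric {χ : Space s K} {g : (Fin s → ℝ) → K}
    (h : (χ, g) ∈ trigonometric s K) (t : ℕ) :
    ((W.unitary ^ t) χ, fun p => (W.symbol p ^ t) (g p)) ∈ trigonometric s K := by
  induction t with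
  | zero => simpa using h
  | succ t ih =>
    have h1 := map_mem_trigonometric (LinearMap.prodMap
      (W.unitary.toContinuousLinearEquiv : Space s K →L[ℂ] Space s K).toLinearMap
      (LinearMap.pi fun p => (W.symbol p).toLinearMap.comp (LinearMap.proj p)))
      (fun x v => ?_) ih
    · rw [pow_succ']
      convert! h1 using 2
      funext p
      rw [pow_succ']
      rfl
    · have h2 : LinearMap.pi (fun p => (W.symbol p).toLinearMap.comp (LinearMap.proj p))
          (planeWaveFun x v) = ∑ z ∈ W.neighborhood, planeWaveFun (x + z) (W.coin z v) := by
        funext p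
        rw [Finset.sum_apply]
        exact W.symbol_planeWaveFun x v p
      have h3 : (W.unitary.toContinuousLinearEquiv : Space s K →L[ℂ] Space s K).toLinearMap
          (lp.single 2 x v) = ∑ z ∈ W.neighborhood, lp.single 2 (x + z) (W.coin z v) :=
        W.unitary_single x v
      rw [LinearMap.prodMap_apply, h2, h3]
      exact sum_single_mem_trigonometric _ (fun z => x + z) fun z => W.coin z v

/-- Unitarity of `W`, tested on the orthogonal vectors `δ₀ ⊗ v` and `δ_{-z} ⊗ v` when `z ≠ 0`. -/
theorem sum_inner_coin (z : Fin s → ℤ) (v : K) :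
    ∑ x ∈ W.neighborhood, ⟪W.coin x v, W.coin (x + z) v⟫_ℂ =
      if z = 0 then ⟪v, v⟫_ℂ else 0 := by
  have h1 : ⟪W.unitary (lp.single 2 0 v), W.unitary (lp.single 2 (-z) v)⟫_ℂ =
      ∑ x ∈ W.neighborhood, ⟪W.coin x v, W.coin (x + z) v⟫_ℂ := by
    rw [lp.inner_eq_tsum, tsum_eq_sum (s := W.neighborhood)]
    · refine Finset.sum_congr rfl fun x _ => ?_
      rw [unitary_single_apply, unitary_single_apply, sub_zero, sub_neg_eq_add]
    · intro x hx
      rw [unitary_single_apply, sub_zero, W.coin_eq_zero hx]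
      exact inner_zero_left _
  rw [← h1, LinearIsometryEquiv.inner_map_map, lp.inner_single_left]
  split_ifs with h
  · subst h
    rw [neg_zero, lp.single_apply_self]
  · rw [lp.single_apply_ne _ _ _ (by simpa [eq_comm] using h), inner_zero_right]

theorem norm_symbol_apply (p : Fin s → ℝ) (v : K) : ‖W.symbol p v‖ = ‖v‖ := by
  classical
  -- All differences of neighbourhood points, over which the double sum is regrouped. The point `0`
  -- is inserted so that the surviving term is present in any case.
  set M : Finset (Fin s → ℤ) :=
    insert 0 (Finset.image₂ (fun x y => y - x) W.neighborhood W.neighborhood) with hM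
  have key : ⟪W.symbol p v, W.symbol p v⟫_ℂ = ⟪v, v⟫_ℂ := by
    have hxy : ∀ x y : Fin s → ℤ, ⟪Complex.exp (Complex.I * (dot p x : ℂ)) • W.coin x v,
        Complex.exp (Complex.I * (dot p y : ℂ)) • W.coin y v⟫_ℂ =
        Complex.exp (Complex.I * (dot p (y - x) : ℂ)) * ⟪W.coin x v, W.coin y v⟫_ℂ := by
      intro x y
      have : dot p (y - x) = dot p y - dot p x := by
        simp [dot, mul_sub, Finset.sum_sub_distrib]
      rw [inner_smul_left, inner_smul_right, ← Complex.exp_conj, map_mul, Complex.conj_I,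
        Complex.conj_ofReal, ← mul_assoc, ← Complex.exp_add, this, Complex.ofReal_sub]
      congr 2
      ring
    have hshift : ∀ x ∈ W.neighborhood, ∑ y ∈ W.neighborhood,
        Complex.exp (Complex.I * (dot p (y - x) : ℂ)) * ⟪W.coin x v, W.coin y v⟫_ℂ =
        ∑ z ∈ M, Complex.exp (Complex.I * (dot p z : ℂ)) * ⟪W.coin x v, W.coin (x + z) v⟫_ℂ := by
      intro x hx
      refine Finset.sum_of_injOn (fun y => y - x) (fun a _ b _ hab => sub_left_injective hab)
        (fun y hy => ?_) (fun z _ hz => ?_) (fun y _ => ?_)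
      · exact Finset.mem_coe.mpr (Finset.mem_insert_of_mem (Finset.mem_image₂_of_mem hx hy))
      · have : x + z ∉ W.neighborhood := fun h => hz ⟨x + z, h, by simp⟩
        rw [W.coin_eq_zero this]
        simp
      · simp
    rw [symbol_apply, sum_inner]
    simp_rw [inner_sum, hxy]
    rw [Finset.sum_congr rfl hshift, Finset.sum_comm]
    simp_rw [← Finset.mul_sum, sum_inner_coin]
    rw [Finset.sum_eq_single 0]
    · simp [dot]
    · intro z _ hz
      simp [hz]
    · exact fun h => absurd (Finset.mem_insert_self _ _) h
  rw [inner_self_eq_norm_sq_to_K, inner_self_eq_norm_sq_to_K] at key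
  have h2 : ‖W.symbol p v‖ ^ 2 = ‖v‖ ^ 2 := by exact_mod_cast key
  exact (sq_eq_sq₀ (norm_nonneg _) (norm_nonneg _)).mp h2

theorem norm_symbol_pow_apply (p : Fin s → ℝ) (t : ℕ) (v : K) :
    ‖(W.symbol p ^ t) v‖ = ‖v‖ := by
  induction t with
  | zero => simp
  | succ t ih =>
    rw [pow_succ', ← ih]
    exact W.norm_symbol_apply p _

theorem inner_evolvedPosition (t : ℕ) (f : BoundedBorel s) (φ ψ : Space s K) :
    ⟪φ, W.evolvedPosition t f ψ⟫_ℂ =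
      ⟪(W.unitary ^ t) φ, scaledPosition t f ((W.unitary ^ t) ψ)⟫_ℂ := by
  rw [← (W.unitary ^ t).inner_map_map φ]
  congr 1
  exact (W.unitary ^ t).apply_symm_apply _

theorem norm_inner_evolvedPosition_le (t : ℕ) {f : BoundedBorel s} {C : ℝ} (hC : 0 ≤ C)
    (hf : ∀ v, ‖f.toFun v‖ ≤ C) (φ ψ : Space s K) :
    ‖⟪φ, W.evolvedPosition t f ψ⟫_ℂ‖ ≤ C * ‖φ‖ * ‖ψ‖ := by
  rw [inner_evolvedPosition]
  refine (norm_inner_le_norm _ _).trans ?_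
  rw [LinearIsometryEquiv.norm_map]
  have := ContinuousLinearMap.le_of_opNorm_le _ (norm_scaledPosition_le (K := K) t hC hf)
    ((W.unitary ^ t) ψ)
  rw [LinearIsometryEquiv.norm_map] at this
  calc ‖φ‖ * _ ≤ ‖φ‖ * (C * ‖ψ‖) := mul_le_mul_of_nonneg_left this (norm_nonneg _)
    _ = C * ‖φ‖ * ‖ψ‖ := by ring

variable [CompleteSpace K] [FiniteDimensional ℂ K]

/-- Dominated convergence in momentum space: the symbol is isometric, so the product of the bounds
of `g` and `h` dominates for all `t`, and the pointwise limit is `tendsto_inner_symbol_pow` with the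
moving vector `h (p + l/t)`. -/
theorem tendsto_inner_evolvedPosition_of_trigonometric
    (hreg : ∀ᵐ p ∂momentumMeasure s, W.IsRegular p) (l : Fin s → ℝ) {φ ψ : Space s K}
    {g h : (Fin s → ℝ) → K} (hφ : (φ, g) ∈ trigonometric s K) (hψ : (ψ, h) ∈ trigonometric s K) :
    Tendsto (fun t : ℕ => ⟪φ, W.evolvedPosition t (BoundedBorel.character l) ψ⟫_ℂ) atTop
      (𝓝 ⟪φ, velocityCalculus hreg (BoundedBorel.character l) ψ⟫_ℂ) := by
  have hlhs : ∀ t : ℕ, ⟪φ, W.evolvedPosition t (BoundedBorel.character l) ψ⟫_ℂ =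
      ∫ p, ⟪(W.symbol p ^ t) (g p),
        (W.symbol (p + (t : ℝ)⁻¹ • l) ^ t) (h (p + (t : ℝ)⁻¹ • l))⟫_ℂ ∂momentumMeasure s := by
    intro t
    rw [inner_evolvedPosition, ← (fourier : Space s K →ₗᵢ[ℂ] _).inner_map_map, L2.inner_def]
    refine integral_congr_ae ?_
    filter_upwards [trigonometric_fourier (W.walk_mem_trigonometric hφ t),
      trigonometric_fourier (shift_mem_trigonometric t l (W.walk_mem_trigonometric hψ t))]
      with p h1 h2
    rw [h1, h2]
  have hrhs : ⟪φ, velocityCalculus hreg (BoundedBorel.character l) ψ⟫_ℂ =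
      ∫ p, ⟪g p, jointCalculus (W.groupVelocity p) (BoundedBorel.character l) (h p)⟫_ℂ
        ∂momentumMeasure s := by
    rw [inner_velocityCalculus]
    refine integral_congr_ae ?_
    filter_upwards [trigonometric_fourier hφ, trigonometric_fourier hψ] with p h1 h2
    rw [h1, h2]
  simp_rw [hlhs]
  rw [hrhs]
  obtain ⟨C, hC⟩ := trigonometric_bounded hφ
  obtain ⟨D, hD⟩ := trigonometric_bounded hψ
  have hgc := trigonometric_continuous hφ
  have hhc := trigonometric_continuous hψ
  refine tendsto_integral_of_dominated_convergence (fun _ => C * D) (fun t => ?_)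
    (integrable_const _) (fun t => ae_of_all _ fun p => ?_) ?_
  · refine Continuous.aestronglyMeasurable (Continuous.inner ?_ ?_)
    · exact (W.symbol_continuous.pow t).clm_apply hgc
    · have hs : Continuous fun p : Fin s → ℝ => p + (t : ℝ)⁻¹ • l := by fun_prop
      exact ((W.symbol_continuous.comp hs).pow t).clm_apply (hhc.comp hs)
  · refine (norm_inner_le_norm _ _).trans ?_
    rw [norm_symbol_pow_apply, norm_symbol_pow_apply]
    exact mul_le_mul (hC _) (hD _) (norm_nonneg _) ((norm_nonneg _).trans (hC p))
  · filter_upwards [hreg] with p hp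
    rw [hp.some.jointCalculus_groupVelocity]
    refine hp.some.tendsto_inner_symbol_pow l (g p) (h p) ?_
    have hq : Tendsto (fun t : ℕ => p + (t : ℝ)⁻¹ • l) atTop (𝓝 p) := by
      simpa using ((tendsto_inv_atTop_nhds_zero_nat (𝕜 := ℝ)).smul_const l).const_add p
    exact (hhc.tendsto p).comp hq

/-- For characters `f`, the operators `f(Q(t)/t)` converge weakly to `f(V)`. -/
theorem tendsto_inner_evolvedPosition_character
    (hreg : ∀ᵐ p ∂momentumMeasure s, W.IsRegular p) (l : Fin s → ℝ) (φ ψ : Space s K) :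
    Tendsto (fun t : ℕ => ⟪φ, W.evolvedPosition t (BoundedBorel.character l) ψ⟫_ℂ) atTop
      (𝓝 ⟪φ, velocityCalculus hreg (BoundedBorel.character l) ψ⟫_ℂ) := by
  set A := velocityCalculus hreg (BoundedBorel.character l) with hA
  set B : ℕ → Space s K →L[ℂ] Space s K := fun t =>
    W.evolvedPosition t (BoundedBorel.character l) - A with hB
  set C : ℝ := 1 + ‖A‖ with hCdef
  have hC : 0 < C := by positivity
  have hBn : ∀ t (a b : Space s K), ‖⟪a, B t b⟫_ℂ‖ ≤ C * ‖a‖ * ‖b‖ := by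
    intro t a b
    have h1 := W.norm_inner_evolvedPosition_le t zero_le_one
      (fun v => (BoundedBorel.norm_character l v).le) a b
    have h2 : ‖⟪a, A b⟫_ℂ‖ ≤ ‖A‖ * ‖a‖ * ‖b‖ := by
      refine (norm_inner_le_norm _ _).trans ?_
      calc ‖a‖ * ‖A b‖ ≤ ‖a‖ * (‖A‖ * ‖b‖) :=
            mul_le_mul_of_nonneg_left (A.le_opNorm b) (norm_nonneg _)
        _ = _ := by ring
    rw [hB, sub_apply, inner_sub_right]
    refine (norm_sub_le _ _).trans ((add_le_add h1 h2).trans_eq ?_)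
    rw [hCdef]
    ring
  suffices h : Tendsto (fun t => ⟪φ, B t ψ⟫_ℂ) atTop (𝓝 0) by
    have h1 := h.add_const ⟪φ, A ψ⟫_ℂ
    rw [zero_add] at h1
    refine h1.congr fun t => ?_
    rw [hB, sub_apply, inner_sub_right, sub_add_cancel]
  rw [Metric.tendsto_nhds]
  intro ε hε
  -- `B t` is bounded by `C` uniformly in `t`. The second radius depends on `‖χ₁‖`, so `χ₁` is fixed
  -- first; the `+ 1` keeps the denominators positive.
  obtain ⟨χ₁, g₁, h1, hd1⟩ := exists_trigonometric_norm_sub_lt φ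
    (show 0 < ε / 3 / (C * (‖ψ‖ + 1)) by positivity)
  obtain ⟨χ₂, g₂, h2, hd2⟩ := exists_trigonometric_norm_sub_lt ψ
    (show 0 < ε / 3 / (C * (‖χ₁‖ + 1)) by positivity)
  have h3 := (W.tendsto_inner_evolvedPosition_of_trigonometric hreg l h1 h2).sub_const
    ⟪χ₁, A χ₂⟫_ℂ
  rw [sub_self] at h3
  filter_upwards [Metric.tendsto_nhds.mp h3 (ε / 3) (by positivity)] with t ht
  rw [dist_zero_right] at ht ⊢
  have e : ⟪φ, B t ψ⟫_ℂ = ⟪φ - χ₁, B t ψ⟫_ℂ + ⟪χ₁, B t (ψ - χ₂)⟫_ℂ + ⟪χ₁, B t χ₂⟫_ℂ := by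
    rw [map_sub, inner_sub_left, inner_sub_right]
    ring
  have ht' : ‖⟪χ₁, B t χ₂⟫_ℂ‖ < ε / 3 := by
    rwa [hB, sub_apply, inner_sub_right]
  have b1 : ‖⟪φ - χ₁, B t ψ⟫_ℂ‖ ≤ ε / 3 := by
    refine (hBn _ _ _).trans ?_
    rw [lt_div_iff₀ (by positivity)] at hd1
    nlinarith [norm_nonneg (φ - χ₁), norm_nonneg ψ, mul_nonneg hC.le (norm_nonneg (φ - χ₁))]
  have b2 : ‖⟪χ₁, B t (ψ - χ₂)⟫_ℂ‖ ≤ ε / 3 := by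
    refine (hBn _ _ _).trans ?_
    rw [lt_div_iff₀ (by positivity)] at hd2
    nlinarith [norm_nonneg (ψ - χ₂), norm_nonneg χ₁, mul_nonneg hC.le (norm_nonneg (ψ - χ₂))]
  rw [e]
  refine (norm_add₃_le).trans_lt ?_
  linarith

end QuantumWalk

/-! ## Traces against a state -/

section Trace

variable {E : Type*} [NormedAddCommGroup E] [InnerProductSpace ℂ E]

theorem hasSum_norm_inner_sq {κ : Type*} (c : HilbertBasis κ ℂ E) (y : E) :
    HasSum (fun j => ‖⟪c j, y⟫_ℂ‖ ^ 2) (‖y‖ ^ 2) := by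
  have h := c.hasSum_inner_mul_inner y y
  rw [inner_self_eq_norm_sq_to_K] at h
  refine Complex.hasSum_ofReal.mp ?_
  rw [Complex.ofReal_pow]
  refine h.congr_fun fun j => ?_
  rw [← inner_conj_symm y (c j), RCLike.conj_mul]
  norm_cast

theorem summable_norm_inner_sq {ι κ : Type*} (c : HilbertBasis κ ℂ E) {y : ι → E}
    (hy : Summable fun i => ‖y i‖ ^ 2) :
    Summable fun ij : ι × κ => ‖⟪c ij.2, y ij.1⟫_ℂ‖ ^ 2 := by
  rw [summable_prod_of_nonneg fun _ => by positivity]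
  refine ⟨fun i => (hasSum_norm_inner_sq c (y i)).summable, ?_⟩
  simpa only [(hasSum_norm_inner_sq c _).tsum_eq] using hy

/-- Cyclicity of the trace: for a self-adjoint Hilbert-Schmidt operator `S`, the trace of `S² A`
can be computed as the trace of `S A S`, in any pair of Hilbert bases. -/
theorem hasSum_inner_sq_comp [CompleteSpace E] {ι κ : Type*} (b : HilbertBasis ι ℂ E)
    (c : HilbertBasis κ ℂ E) {S : E →L[ℂ] E} (hS : ∀ x y, ⟪S x, y⟫_ℂ = ⟪x, S y⟫_ℂ)
    (hsum : Summable fun i => ‖S (b i)‖ ^ 2) (A : E →L[ℂ] E) {T : ℂ}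
    (hT : HasSum (fun i => ⟪S (b i), A (S (b i))⟫_ℂ) T) :
    HasSum (fun j => ⟪c j, S (S (A (c j)))⟫_ℂ) T := by
  -- Expanding `⟪A* S bᵢ, S bᵢ⟫` in the basis `c` gives a double family, absolutely summable because
  -- `S` and `A* S` are Hilbert-Schmidt. Summing over `j` first yields `T`, summing over `i` first
  -- yields the terms `⟪c j, S S A (c j)⟫`.
  set F : ι × κ → ℂ := fun ij =>
    ⟪ContinuousLinearMap.adjoint A (S (b ij.1)), c ij.2⟫_ℂ * ⟪c ij.2, S (b ij.1)⟫_ℂ with hF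
  have hsum' : Summable fun i => ‖ContinuousLinearMap.adjoint A (S (b i))‖ ^ 2 := by
    refine Summable.of_nonneg_of_le (fun _ => by positivity) (fun i => ?_)
      (hsum.mul_left (‖ContinuousLinearMap.adjoint A‖ ^ 2))
    rw [← mul_pow]
    exact pow_le_pow_left₀ (norm_nonneg _) (ContinuousLinearMap.le_opNorm _ _) 2
  have hFs : Summable F := by
    refine Summable.of_norm_bounded
      ((summable_norm_inner_sq c hsum').add (summable_norm_inner_sq c hsum)) fun ij => ?_
    rw [hF, norm_mul, norm_inner_symm]
    nlinarith [sq_nonneg (‖⟪c ij.2, ContinuousLinearMap.adjoint A (S (b ij.1))⟫_ℂ‖ -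
      ‖⟪c ij.2, S (b ij.1)⟫_ℂ‖), sq_nonneg ‖⟪c ij.2, S (b ij.1)⟫_ℂ‖,
      sq_nonneg ‖⟪c ij.2, ContinuousLinearMap.adjoint A (S (b ij.1))⟫_ℂ‖]
  have h1 : ∀ i, HasSum (fun j => F (i, j)) ⟪S (b i), A (S (b i))⟫_ℂ := by
    intro i
    have := c.hasSum_inner_mul_inner (ContinuousLinearMap.adjoint A (S (b i))) (S (b i))
    rwa [ContinuousLinearMap.adjoint_inner_left] at this
  have hFT : HasSum F T := by
    have := hFs.hasSum.prod_fiberwise h1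
    rw [hT.unique this]
    exact hFs.hasSum
  have h2 : ∀ j, HasSum (fun i => F (i, j)) ⟪c j, S (S (A (c j)))⟫_ℂ := by
    intro j
    have := b.hasSum_inner_mul_inner (S (c j)) (S (A (c j)))
    rw [hS] at this
    refine this.congr_fun fun i => ?_
    rw [hF]
    simp only
    rw [ContinuousLinearMap.adjoint_inner_left, hS (b i) (A (c j)), hS (c j) (b i), mul_comm]
  exact ((Equiv.prodComm κ ι).hasSum_iff.mpr hFT).prod_fiberwise h2

end Trace

/-! ## Convergence in distribution -/

section Convergence

variable {s : ℕ} {E : Type*} [NormedAddCommGroup E] [InnerProductSpace ℂ E]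

theorem IsSpectralCalculus.norm_inner_character_le {Φ : BoundedBorel s → E →L[ℂ] E}
    (hΦ : IsSpectralCalculus Φ) (l : Fin s → ℝ) (ψ : E) :
    ‖⟪ψ, Φ (BoundedBorel.character l) ψ⟫_ℂ‖ ≤ ‖ψ‖ ^ 2 := by
  obtain ⟨m, hm, hf⟩ := hΦ ψ
  rw [hf]
  refine (norm_integral_le_integral_norm _).trans ?_
  simp_rw [BoundedBorel.norm_character]
  rw [integral_const, measureReal_def, hm, ENNReal.toReal_ofReal (by positivity)]
  simp

/-- The distribution of a spectral calculus in a mixture of the vector states `ψ i`. -/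
theorem IsSpectralCalculus.exists_probabilityMeasure {Φ : BoundedBorel s → E →L[ℂ] E}
    (hΦ : IsSpectralCalculus Φ) {ι : Type*} {ψ : ι → E} (hψ : HasSum (fun i => ‖ψ i‖ ^ 2) 1) :
    ∃ P : ProbabilityMeasure (Fin s → ℝ),
      ∀ f, HasSum (fun i => ⟪ψ i, Φ f (ψ i)⟫_ℂ) (∫ v, f.toFun v ∂(P : Measure (Fin s → ℝ))) := by
  choose m hm hf using hΦ
  have hP : IsProbabilityMeasure (Measure.sum fun i => m (ψ i)) := by
    refine ⟨?_⟩
    rw [Measure.sum_apply _ MeasurableSet.univ]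
    simp_rw [hm]
    rw [← ENNReal.ofReal_tsum_of_nonneg (fun _ => by positivity) hψ.summable, hψ.tsum_eq,
      ENNReal.ofReal_one]
  refine ⟨⟨_, hP⟩, fun f => ?_⟩
  simp_rw [hf]
  exact hasSum_integral_measure (f.integrable _)

/-- Lévy's continuity theorem. Characteristic functions refer to an inner product, so the measures
are moved to `EuclideanSpace` and back along the continuous identification. -/
theorem tendsto_of_tendsto_character {μ : ℕ → ProbabilityMeasure (Fin s → ℝ)}
    {ν : ProbabilityMeasure (Fin s → ℝ)}
    (h : ∀ l, Tendsto (fun t => ∫ v, (BoundedBorel.character l).toFun v ∂(μ t : Measure (Fin s → ℝ))) atTop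
      (𝓝 (∫ v, (BoundedBorel.character l).toFun v ∂(ν : Measure (Fin s → ℝ))))) :
    Tendsto μ atTop (𝓝 ν) := by
  have hto : Continuous (WithLp.toLp 2 : (Fin s → ℝ) → EuclideanSpace ℝ (Fin s)) :=
    PiLp.continuous_toLp 2 _
  have hof : Continuous (WithLp.ofLp : EuclideanSpace ℝ (Fin s) → Fin s → ℝ) :=
    PiLp.continuous_ofLp 2 _
  have hchar : ∀ (P : ProbabilityMeasure (Fin s → ℝ)) (l : EuclideanSpace ℝ (Fin s)),
      charFun (P.map hto.measurable.aemeasurable : Measure _) l =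
        ∫ v, (BoundedBorel.character l.ofLp).toFun v ∂(P : Measure (Fin s → ℝ)) := by
    intro P l
    rw [charFun_apply, ProbabilityMeasure.toMeasure_map,
      integral_map hto.measurable.aemeasurable (by fun_prop)]
    refine integral_congr_ae (ae_of_all _ fun v => ?_)
    simp only [BoundedBorel.character, PiLp.inner_apply, mul_comm Complex.I]
    simp
  have h1 : Tendsto (fun t => (μ t).map hto.measurable.aemeasurable) atTop
      (𝓝 (ν.map hto.measurable.aemeasurable)) := by
    rw [ProbabilityMeasure.tendsto_iff_tendsto_charFun]
    intro l
    simp_rw [hchar]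
    exact h l.ofLp
  have h2 := ProbabilityMeasure.tendsto_map_of_tendsto_of_continuous _ _ h1 hof
  have hback : ∀ P : ProbabilityMeasure (Fin s → ℝ),
      (P.map hto.measurable.aemeasurable).map hof.measurable.aemeasurable = P := by
    intro P
    refine Subtype.ext ?_
    rw [ProbabilityMeasure.val_eq_to_measure, ProbabilityMeasure.toMeasure_map,
      ProbabilityMeasure.toMeasure_map, Measure.map_map hof.measurable hto.measurable]
    exact Measure.map_id
  simpa only [hback] using h2

variable {Φ : ℕ → BoundedBorel s → E →L[ℂ] E} {Φ' : BoundedBorel s → E →L[ℂ] E}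

/-- If characters converge weakly, distributions in mixed states converge weakly. -/
theorem exists_tendsto_of_tendsto_character (hΦ : ∀ t, IsSpectralCalculus (Φ t))
    (hΦ' : IsSpectralCalculus Φ')
    (hc : ∀ l ψ, Tendsto (fun t => ⟪ψ, Φ t (BoundedBorel.character l) ψ⟫_ℂ) atTop
      (𝓝 ⟪ψ, Φ' (BoundedBorel.character l) ψ⟫_ℂ))
    {ι : Type*} {ψ : ι → E} (hψ : HasSum (fun i => ‖ψ i‖ ^ 2) 1) :
    ∃ (μ : ℕ → ProbabilityMeasure (Fin s → ℝ)) (ν : ProbabilityMeasure (Fin s → ℝ)),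
      (∀ t f, HasSum (fun i => ⟪ψ i, Φ t f (ψ i)⟫_ℂ)
        (∫ v, f.toFun v ∂(μ t : Measure (Fin s → ℝ)))) ∧
      (∀ f, HasSum (fun i => ⟪ψ i, Φ' f (ψ i)⟫_ℂ) (∫ v, f.toFun v ∂(ν : Measure (Fin s → ℝ)))) ∧
      Tendsto μ atTop (𝓝 ν) := by
  choose μ hμ using fun t => (hΦ t).exists_probabilityMeasure hψ
  obtain ⟨ν, hν⟩ := hΦ'.exists_probabilityMeasure hψ
  refine ⟨μ, ν, hμ, hν, tendsto_of_tendsto_character fun l => ?_⟩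
  simp_rw [← (hμ _ _).tsum_eq, ← (hν _).tsum_eq]
  -- The `i`-th term is bounded by `‖ψ i‖²` for every `t`, and these bounds sum to one.
  exact tendsto_tsum_of_dominated_convergence hψ.summable (fun i => hc l (ψ i))
    (Eventually.of_forall fun t i => (hΦ t).norm_inner_character_le l (ψ i))

/-- If characters converge weakly, continuous functions vanishing at infinity do. -/
theorem tendsto_inner_ofC0_of_tendsto_character (hΦ : ∀ t, IsSpectralCalculus (Φ t))
    (hΦ' : IsSpectralCalculus Φ')
    (hc : ∀ l ψ, Tendsto (fun t => ⟪ψ, Φ t (BoundedBorel.character l) ψ⟫_ℂ) atTop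
      (𝓝 ⟪ψ, Φ' (BoundedBorel.character l) ψ⟫_ℂ))
    (f : C₀(Fin s → ℝ, ℂ)) (φ ψ : E) :
    Tendsto (fun t => ⟪φ, Φ t (BoundedBorel.ofC0 f) ψ⟫_ℂ) atTop
      (𝓝 ⟪φ, Φ' (BoundedBorel.ofC0 f) ψ⟫_ℂ) := by
  have hunit : ∀ u : E, ‖u‖ = 1 → Tendsto (fun t => ⟪u, Φ t (BoundedBorel.ofC0 f) u⟫_ℂ) atTop
      (𝓝 ⟪u, Φ' (BoundedBorel.ofC0 f) u⟫_ℂ) := by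
    intro u hu
    -- A unit vector is a mixture with a single component.
    have hsum : HasSum (fun _ : Unit => ‖u‖ ^ 2) 1 := by
      rw [hu, one_pow]
      exact hasSum_unique _
    obtain ⟨μ, ν, hμ, hν, hlim⟩ := exists_tendsto_of_tendsto_character hΦ hΦ' hc hsum
    have h1 : ∀ t, ⟪u, Φ t (BoundedBorel.ofC0 f) u⟫_ℂ = ∫ v, f v ∂(μ t : Measure (Fin s → ℝ)) := fun t =>
      (hasSum_unique _).unique (hμ t (BoundedBorel.ofC0 f))
    have h2 : ⟪u, Φ' (BoundedBorel.ofC0 f) u⟫_ℂ = ∫ v, f v ∂(ν : Measure (Fin s → ℝ)) :=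
      (hasSum_unique _).unique (hν (BoundedBorel.ofC0 f))
    simp_rw [h1]
    rw [h2]
    exact (ProbabilityMeasure.tendsto_iff_forall_integral_rclike_tendsto ℂ).mp hlim f.toBCF
  have hdiag : ∀ u : E, Tendsto (fun t => ⟪u, Φ t (BoundedBorel.ofC0 f) u⟫_ℂ) atTop
      (𝓝 ⟪u, Φ' (BoundedBorel.ofC0 f) u⟫_ℂ) := by
    intro u
    by_cases hu : u = 0
    · subst hu
      simp
    · have h1 := (hunit ((‖u‖⁻¹ : ℂ) • u) (norm_smul_inv_norm hu)).const_mul ((‖u‖ : ℂ) ^ 2)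
      have hne : (‖u‖ : ℂ) ≠ 0 := by exact_mod_cast norm_ne_zero_iff.mpr hu
      have h2 : ∀ A : E →L[ℂ] E,
          (‖u‖ : ℂ) ^ 2 * ⟪(‖u‖⁻¹ : ℂ) • u, A ((‖u‖⁻¹ : ℂ) • u)⟫_ℂ = ⟪u, A u⟫_ℂ := by
        intro A
        rw [map_smul, inner_smul_left, inner_smul_right, map_inv₀, Complex.conj_ofReal]
        field_simp
      simpa only [h2] using h1
  -- Polarization reduces matrix elements to diagonal ones.
  have hpol : ∀ A : E →L[ℂ] E, ⟪φ, A ψ⟫_ℂ =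
      (⟪φ + ψ, A (φ + ψ)⟫_ℂ - ⟪φ - ψ, A (φ - ψ)⟫_ℂ -
        Complex.I * ⟪φ + Complex.I • ψ, A (φ + Complex.I • ψ)⟫_ℂ +
        Complex.I * ⟪φ - Complex.I • ψ, A (φ - Complex.I • ψ)⟫_ℂ) / 4 := by
    intro A
    simp only [map_add, map_sub, map_smul, inner_add_left, inner_add_right, inner_sub_left,
      inner_sub_right, inner_smul_left, inner_smul_right, Complex.conj_I]
    linear_combination (-(1 / 2) * ⟪ψ, A φ⟫_ℂ + (1 / 2) * ⟪φ, A ψ⟫_ℂ) * Complex.I_sq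
  simp_rw [hpol]
  exact ((((hdiag _).sub (hdiag _)).sub ((hdiag _).const_mul _)).add
    ((hdiag _).const_mul _)).div_const 4

end Convergence

/-! ### Square roots of density operators -/

section States

variable {E : Type u} [NormedAddCommGroup E] [InnerProductSpace ℂ E] [CompleteSpace E]

/-- A density operator is the square of a self-adjoint Hilbert-Schmidt operator. -/
theorem IsDensityOperator.exists_sqrt {ρ : E →L[ℂ] E} (hρ : IsDensityOperator ρ) {ι : Type u}
    (b : HilbertBasis ι ℂ E) :
    ∃ S : E →L[ℂ] E, (∀ x y, ⟪S x, y⟫_ℂ = ⟪x, S y⟫_ℂ) ∧ (∀ x, S (S x) = ρ x) ∧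
      HasSum (fun i => ‖S (b i)‖ ^ 2) 1 := by
  have h0 : 0 ≤ ρ := (ContinuousLinearMap.nonneg_iff_isPositive ρ).mpr hρ.1
  have hsa : IsSelfAdjoint (CFC.sqrt ρ) := (CFC.sqrt_nonneg ρ).isSelfAdjoint
  have hsymm : ∀ x y, ⟪CFC.sqrt ρ x, y⟫_ℂ = ⟪x, CFC.sqrt ρ y⟫_ℂ := fun x y =>
    hsa.isSymmetric x y
  have hsq : ∀ x, CFC.sqrt ρ (CFC.sqrt ρ x) = ρ x := fun x =>
    congrArg (fun T : E →L[ℂ] E => T x) (CFC.sqrt_mul_sqrt_self ρ h0)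
  refine ⟨CFC.sqrt ρ, hsymm, hsq, ?_⟩
  have h1 := hρ.2 b
  refine Complex.hasSum_ofReal.mp ?_
  rw [Complex.ofReal_one]
  convert! h1 using 2 with i
  rw [← hsq, ← hsymm, inner_self_eq_norm_sq_to_K, Complex.ofReal_pow]
  rfl

end States

/-! ### Spectral measures of the evolved position -/

namespace QuantumWalk

variable {s : ℕ} {K : Type u} [NormedAddCommGroup K] [InnerProductSpace ℂ K]
  (W : QuantumWalk s K)

/-- The spectral measure puts mass `‖(W^t ψ)(x)‖²` at `x/t`. At `t = 0` division by zero moves all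
mass to the origin, in accordance with `scaledPosition`, so no exception is needed. -/
theorem isSpectralCalculus_evolvedPosition (t : ℕ) : IsSpectralCalculus (W.evolvedPosition t) := by
  intro ψ
  set χ := (W.unitary ^ t) ψ with hχ
  have hnorm : HasSum (fun x => ‖χ x‖ ^ 2) (‖ψ‖ ^ 2) := by
    have h := lp.hasSum_inner (𝕜 := ℂ) χ χ
    refine Complex.hasSum_ofReal.mp ?_
    rw [← (W.unitary ^ t).norm_map ψ, Complex.ofReal_pow]
    rw [inner_self_eq_norm_sq_to_K] at h
    convert! h using 2 with x
    rw [inner_self_eq_norm_sq_to_K, Complex.ofReal_pow]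
    rfl
  set m : Measure (Fin s → ℝ) := Measure.sum fun x : Fin s → ℤ =>
    ENNReal.ofReal (‖χ x‖ ^ 2) • Measure.dirac fun i => (x i : ℝ) / (t : ℝ) with hm
  have huniv : m Set.univ = ENNReal.ofReal (‖ψ‖ ^ 2) := by
    rw [hm, Measure.sum_apply _ MeasurableSet.univ]
    simp only [Measure.smul_apply, measure_univ, smul_eq_mul, mul_one]
    rw [← ENNReal.ofReal_tsum_of_nonneg (fun _ => by positivity) hnorm.summable, hnorm.tsum_eq]
  have : IsFiniteMeasure m := ⟨by rw [huniv]; exact ENNReal.ofReal_lt_top⟩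
  refine ⟨m, huniv, fun f => ?_⟩
  have h1 := hasSum_integral_measure (f.integrable m)
  rw [inner_evolvedPosition]
  refine (lp.hasSum_inner (𝕜 := ℂ) χ (scaledPosition t f χ)).unique ?_
  convert! h1 using 2 with x
  rw [scaledPosition_apply, inner_smul_right, inner_self_eq_norm_sq_to_K, integral_smul_measure,
    integral_dirac, ENNReal.toReal_ofReal (by positivity), Complex.real_smul, mul_comm,
    Complex.ofReal_pow]
  rfl

end QuantumWalk

theorem BoundedBorel.integral_indicator {s : ℕ} (m : Measure (Fin s → ℝ)) {B : Set (Fin s → ℝ)}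
    (hB : MeasurableSet B) :
    ∫ v, (BoundedBorel.indicator B hB).toFun v ∂m = ((m.real B : ℝ) : ℂ) := by
  simp only [BoundedBorel.indicator]
  rw [MeasureTheory.integral_indicator hB]
  simp

end QW

end

theorem mainTheorem2 {s : ℕ} {K : Type*} [NormedAddCommGroup K] [InnerProductSpace ℂ K]
    [CompleteSpace K] [FiniteDimensional ℂ K] (W : QW.QuantumWalk s K)
    (hreg : ∀ᵐ p ∂QW.momentumMeasure s, W.IsRegular p) :
    ∃ fV : QW.BoundedBorel s → (QW.Space s K →L[ℂ] QW.Space s K),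
      -- `fV f` is the operator `f(V)`: multiplication by `f(V(p))` in momentum space
      (∀ (f : QW.BoundedBorel s) (ψ : QW.Space s K), ∀ᵐ p ∂QW.momentumMeasure s,
        QW.fourier (fV f ψ) p = QW.jointCalculus (W.groupVelocity p) f (QW.fourier ψ p)) ∧
      -- `f(Q(t) / t)` converges weakly to `f(V)`
      (∀ (f : C₀(Fin s → ℝ, ℂ)) (φ ψ : QW.Space s K),
        Tendsto (fun t : ℕ => ⟪φ, W.evolvedPosition t (QW.BoundedBorel.ofC0 f) ψ⟫_ℂ) atTop
          (𝓝 ⟪φ, fV (QW.BoundedBorel.ofC0 f) ψ⟫_ℂ)) ∧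
      -- in each state `ρ`, the distribution `μ t` of `Q(t) / t` converges weakly to
      -- the distribution `ν` of `V`
      (∀ ρ : QW.Space s K →L[ℂ] QW.Space s K, QW.IsDensityOperator ρ →
        ∃ (μ : ℕ → ProbabilityMeasure (Fin s → ℝ)) (ν : ProbabilityMeasure (Fin s → ℝ)),
          (∀ t : ℕ, 0 < t → ∀ (B : Set (Fin s → ℝ)) (hB : MeasurableSet B),
            QW.HasTrace (ρ ∘L W.evolvedPosition t (QW.BoundedBorel.indicator B hB))
              (((μ t : Measure (Fin s → ℝ)).real B : ℝ) : ℂ)) ∧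
          (∀ (B : Set (Fin s → ℝ)) (hB : MeasurableSet B),
            QW.HasTrace (ρ ∘L fV (QW.BoundedBorel.indicator B hB))
              (((ν : Measure (Fin s → ℝ)).real B : ℝ) : ℂ)) ∧
          Tendsto μ atTop (𝓝 ν)) := by
  have hc := fun l ψ => W.tendsto_inner_evolvedPosition_character hreg l ψ ψ
  refine ⟨QW.QuantumWalk.velocityCalculus hreg, QW.QuantumWalk.fourier_velocityCalculus hreg,
    QW.tendsto_inner_ofC0_of_tendsto_character W.isSpectralCalculus_evolvedPosition
      (QW.QuantumWalk.isSpectralCalculus_velocityCalculus hreg) hc, fun ρ hρ => ?_⟩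
  -- One basis `b` serves to build the measures from the vectors `S (b i)`; the trace formula is
  -- then transferred to an arbitrary basis `c`.
  obtain ⟨w, b, -⟩ := exists_hilbertBasis ℂ (QW.Space s K)
  obtain ⟨S, hS, hSρ, hsum⟩ := hρ.exists_sqrt b
  obtain ⟨μ, ν, hμ, hν, hlim⟩ := QW.exists_tendsto_of_tendsto_character
    W.isSpectralCalculus_evolvedPosition
    (QW.QuantumWalk.isSpectralCalculus_velocityCalculus hreg) hc hsum
  refine ⟨μ, ν, fun t _ B hB ι c => ?_, fun B hB ι c => ?_, hlim⟩
  · rw [← QW.BoundedBorel.integral_indicator _ hB]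
    have h := QW.hasSum_inner_sq_comp b c hS hsum.summable _ (hμ t (QW.BoundedBorel.indicator B hB))
    simp_rw [hSρ] at h
    exact h
  · rw [← QW.BoundedBorel.integral_indicator _ hB]
    have h := QW.hasSum_inner_sq_comp b c hS hsum.summable _ (hν (QW.BoundedBorel.indicator B hB))
    simp_rw [hSρ] at h
    exact h
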